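/- Fix $N\ge 2$ parties. All systems are finite-dimensional; a system $S$ consists of one local Hilbert space per party, and states are density operators on the tensor product of the local spaces. An LOCC protocol has finitely many rounds; in each round the parties perform local measurements with finitely many outcomes (given by Kraus operators) and announce the outcomes, on which everything that follows may depend. $\|M\|_1=\mathrm{Tr}\sqrt{M^\dagger M}$ is the trace norm. Let $\rho$ be a state of a system $S$ and $\sigma$ a state of a system $S'$ (for instance $S'=S$) shared by the $N$ parties. * $\rho$ is *reducible onto $\sigma$ in the marginals* if for all $\varepsilon,\delta>0$ there are integers $0\le m\le n$, $n\ge 1$, and an LOCC protocol $\Lambda$ taking $\rho^{\otimes n}$ to a state $\mu_m=\Lambda(\rho^{\otimes n})$ of $m$ copies of $S'$ such that $\|\mu_m^{(i)}-\sigma\|_1<\varepsilon$ for every $i\le m$, where $\mu_m^{(i)}$ is the reduced state on the $i$-th copy, and $\frac mn+\delta>1$. * $\rho$ *can be converted into $\sigma$ via correlated catalysis* if for every $\varepsilon>0$ there are a system $C$ shared by the parties, a state $\tau$ of $C$ and an LOCC protocol $\Lambda$ from $SC$ to $S'C$ such that $\mu=\Lambda(\rho\otimes\tau)$ satisfies $\|\mathrm{Tr}_C\,\mu-\sigma\|_1<\varepsilon$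 and $\mathrm{Tr}_{S'}\,\mu=\tau$. * Let $\Phi_N=\bigotimes_{p<q}|\psi^-\rangle\langle\psi^-|_{pq}$ be the state consisting of one singlet $|\psi^-\rangle=(|01\rangle-|10\rangle)/\sqrt2$ for each pair of parties (each party holds one qubit for every other party; for $N=2$ this is one singlet). The state $\rho$ is *distillable* if there is $r>0$ such that for all $\varepsilon,\delta>0$ there are integers $m\ge 0$, $n\ge1$ and an LOCC protocol $\Lambda$ with $\|\Lambda(\rho^{\otimes n})-\Phi_N^{\otimes m}\|_1<\varepsilon$ and $\frac mn+\delta>r$. **Theorem.** If $\rho$ and $\sigma$ are distillable, then $\rho$ is reducible onto $\sigma$ in the marginals if and only if $\rho$ can be converted into $\sigma$ via correlated catalysis. Moreover, for arbitrary states $\rho$ and $\sigma$, marginal reducibility of $\rho$ onto $\sigma$ implies convertibility of $\rho$ into $\sigma$ via correlated catalysis; and the converse implication holds whenever $\rho$ is distillable (with $\sigma$ arbitrary). -/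

import Mathlib

open scoped Matrix ComplexOrder

namespace QEnt

/-- Operators on the joint Hilbert space `⨂ p, ℂ ^ (d p)` of `N` parties, `ℂ ^ (d p)` being the
space of party `p` with basis `d p`: the product basis is indexed by the tuples `∀ p, d p`. -/
abbrev Op {N : ℕ} (d : Fin N → Type) : Type := Matrix (∀ p, d p) (∀ p, d p) ℂ

/-- A quantum state (density operator). -/
def IsState {ι : Type} [Fintype ι] (ρ : Matrix ι ι ℂ) : Prop := ρ.PosSemidef ∧ ρ.trace = 1

open scoped MatrixOrder in
/-- The trace norm `Tr √(M† M)`. -/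
noncomputable def traceNorm {ι : Type} [Fintype ι] [DecidableEq ι] (M : Matrix ι ι ℂ) : ℝ :=
  (CFC.sqrt (Mᴴ * M)).trace.re

/-- The tensor product `⨂ p, A p` of local operators. -/
def localProd {N : ℕ} {d e : Fin N → Type} (A : ∀ p, Matrix (e p) (d p) ℂ) :
    Matrix (∀ p, e p) (∀ p, d p) ℂ :=
  Matrix.of fun y x => ∏ p, A p (y p) (x p)

/-- Channels implementable by local operations and classical communication, with finitely many
rounds. In one round every party `p` performs a local measurement with finitely many outcomes
`j : κ p` and Kraus operators `A p j`, where `∑ j, (A p j)† (A p j) = 1`, and announces the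
outcome to all parties. The protocol then continues with a protocol `Λ k` that depends on the
tuple `k` of all the announced outcomes. The space of a party after its measurement may differ
from the one before, and may depend on the party's outcome. A party that only waits uses
the identity as its single Kraus operator; a local channel is a measurement whose outcome is
ignored afterwards (in particular, parties may discard subsystems and append local ancillas). -/
inductive IsLOCC {N : ℕ} {e : Fin N → Type} [∀ p, Fintype (e p)] [∀ p, DecidableEq (e p)] :
    {d : Fin N → Type} → [∀ p, Fintype (d p)] → [∀ p, DecidableEq (d p)] →
    (Op d → Op e) → Prop
  | done : IsLOCC (fun X : Op e => X)
  | round {d : Fin N → Type} [∀ p, Fintype (d p)] [∀ p, DecidableEq (d p)]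
      (κ : Fin N → Type) [∀ p, Fintype (κ p)]
      (d' : ∀ p, κ p → Type) [∀ p j, Fintype (d' p j)] [∀ p j, DecidableEq (d' p j)]
      (A : ∀ p j, Matrix (d' p j) (d p) ℂ) (hA : ∀ p, ∑ j, (A p j)ᴴ * A p j = 1)
      (Λ : ∀ k : (∀ p, κ p), Op (fun p => d' p (k p)) → Op e) (hΛ : ∀ k, IsLOCC (Λ k)) :
      IsLOCC (fun X : Op d => ∑ k : (∀ p, κ p),
        Λ k (localProd (fun p => A p (k p)) * X * (localProd (fun p => A p (k p)))ᴴ))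

/-- The local spaces of `n` copies of a system with local spaces `ℂ ^ (d p)`. -/
abbrev Copies {N : ℕ} (d : Fin N → Type) (n : ℕ) : Fin N → Type := fun p => Fin n → d p

/-- `ρ^{⊗ n}`. -/
def power {N : ℕ} {d : Fin N → Type} (ρ : Op d) (n : ℕ) : Op (Copies d n) :=
  Matrix.of fun x y => ∏ i, ρ (fun p => x p i) (fun p => y p i)

/-- The marginal of an `m`-copy operator on the `i`-th copy (all other copies are traced out). -/
def copyMarginal {N : ℕ} {d : Fin N → Type} [∀ p, Fintype (d p)] [∀ p, DecidableEq (d p)]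
    {m : ℕ} (i : Fin m) (μ : Op (Copies d m)) : Op d :=
  Matrix.of fun x y => ∑ u : (∀ p, Fin m → d p) with (fun p => u p i) = x,
    μ u (fun p => Function.update (u p) i (y p))

/-- The local spaces of the system `S C`: each party holds a part of `S` and a part of `C`. -/
abbrev Joint {N : ℕ} (d c : Fin N → Type) : Fin N → Type := fun p => d p × c p

/-- `ρ^S ⊗ τ^C`. -/
def tensor {N : ℕ} {d c : Fin N → Type} (ρ : Op d) (τ : Op c) : Op (Joint d c) :=
  Matrix.of fun x y =>
    ρ (fun p => (x p).1) (fun p => (y p).1) * τ (fun p => (x p).2) (fun p => (y p).2)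

/-- `μ^S = Tr_C μ^{SC}`. -/
def marginalS {N : ℕ} {d c : Fin N → Type} [∀ p, Fintype (c p)] (μ : Op (Joint d c)) : Op d :=
  Matrix.of fun x y => ∑ z : (∀ p, c p), μ (fun p => (x p, z p)) (fun p => (y p, z p))

/-- `μ^C = Tr_S μ^{SC}`. -/
def marginalC {N : ℕ} {d c : Fin N → Type} [∀ p, Fintype (d p)] (μ : Op (Joint d c)) : Op c :=
  Matrix.of fun z w => ∑ x : (∀ p, d p), μ (fun p => (x p, z p)) (fun p => (x p, w p))

section Tasks

variable {N : ℕ} {d e : Fin N → Type} [∀ p, Fintype (d p)] [∀ p, DecidableEq (d p)]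
  [∀ p, Fintype (e p)] [∀ p, DecidableEq (e p)]

/-- `ρ` is reducible onto `σ` in the marginals. -/
def MarginallyReducible (ρ : Op d) (σ : Op e) : Prop :=
  ∀ ε : ℝ, 0 < ε → ∀ δ : ℝ, 0 < δ → ∃ m n : ℕ, 0 < n ∧ m ≤ n ∧
    ∃ Λ : Op (Copies d n) → Op (Copies e m), IsLOCC Λ ∧
      (∀ i : Fin m, traceNorm (copyMarginal i (Λ (power ρ n)) - σ) < ε) ∧
      1 < (m : ℝ) / n + δ

/-- `ρ` can be converted into `σ` via correlated catalysis. -/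
def CatalyticallyConvertible (ρ : Op d) (σ : Op e) : Prop :=
  ∀ ε : ℝ, 0 < ε → ∃ (c : Fin N → Type) (_ : ∀ p, Fintype (c p)) (_ : ∀ p, DecidableEq (c p))
    (τ : Op c) (Λ : Op (Joint d c) → Op (Joint e c)), IsState τ ∧ IsLOCC Λ ∧
      traceNorm (marginalS (Λ (tensor ρ τ)) - σ) < ε ∧
      marginalC (Λ (tensor ρ τ)) = τ

/-- `ρ` can be transformed asymptotically into `σ` at rate `r`. -/
def AchievableRate (ρ : Op d) (σ : Op e) (r : ℝ) : Prop :=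
  ∀ ε : ℝ, 0 < ε → ∀ δ : ℝ, 0 < δ → ∃ m n : ℕ, 0 < n ∧
    ∃ Λ : Op (Copies d n) → Op (Copies e m), IsLOCC Λ ∧
      traceNorm (Λ (power ρ n) - power σ m) < ε ∧
      r < (m : ℝ) / n + δ

end Tasks

/-- The coefficients of the singlet `(|01⟩ - |10⟩) / √2`. -/
noncomputable def singlet (a b : Fin 2) : ℂ :=
  !![0, 1 / (√2 : ℝ); -1 / (√2 : ℝ), 0] a b

/-- Local spaces carrying a singlet between each pair of parties: party `p` holds one qubit for
every other party `q`. -/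
abbrev PairQubits (N : ℕ) : Fin N → Type := fun p => {q : Fin N // q ≠ p} → Fin 2

/-- The state `⨂_{p < q} |ψ⁻⟩⟨ψ⁻|_{pq}` consisting of one singlet for each pair of parties. -/
noncomputable def pairSinglets (N : ℕ) : Op (PairQubits N) :=
  let φ : (∀ p, PairQubits N p) → ℂ := fun x =>
    ∏ pq : {pq : Fin N × Fin N // pq.1 < pq.2},
      singlet (x pq.1.1 ⟨pq.1.2, pq.2.ne'⟩) (x pq.1.2 ⟨pq.1.1, pq.2.ne⟩)
  Matrix.vecMulVec φ (star φ)

/-- `ρ` is distillable: singlets between all pairs of parties can be obtained at nonzero rate. -/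
def Distillable {N : ℕ} {d : Fin N → Type} [∀ p, Fintype (d p)] [∀ p, DecidableEq (d p)]
    (ρ : Op d) : Prop :=
  ∃ r : ℝ, 0 < r ∧ AchievableRate ρ (pairSinglets N) r

end QEnt

/-! For the forward implication let `Λ` turn `n` copies of `ρ` into `m` copies whose marginals are
close to `σ`, with `m / n` close to `1`, padded to `n` copies by arbitrary states. The catalyst is
the uniform mixture over `k < n` of the states `|k⟩⟨k| ⊗ ρ^{⊗ k} ⊗ η k`, where `η k` is the marginal
of `Λ (ρ^{⊗ n})` on its last `n - 1 - k` copies. Each use stores one copy of `ρ`, moves the register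
`k` one step around a cycle and releases one copy of `Λ (ρ^{⊗ n})`; once `n` copies of `ρ` are
available, `Λ` is applied to them. The mixture is preserved exactly, and the output is the average
of the marginals.

For the converse, a catalyst `τ` is fixed first. From a number of copies of `ρ` that does not depend
on how many remain, one distils approximate singlets; one party prepares a purification of `τ` and
teleports their shares to the others. A catalyst stays unchanged when the rest is discarded, so it
serves the remaining copies of `ρ` one after another. As operations do not increase trace distance,
the error made in preparing `τ` enters the marginal of every copy only once. -/

namespace QEnt

section TraceNorm

variable {ι : Type} [Fintype ι]

/-- `X` is a difference of positive semidefinite operators of total trace at most `b`. For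
Hermitian `X` this says that the trace norm of `X` is at most `b`, in a form that positive
trace-preserving maps visibly respect. -/
def TraceBound (b : ℝ) (X : Matrix ι ι ℂ) : Prop :=
  ∃ P Q : Matrix ι ι ℂ, P.PosSemidef ∧ Q.PosSemidef ∧ X = P - Q ∧ (P.trace + Q.trace).re ≤ b

namespace TraceBound

theorem mono {b c : ℝ} {X : Matrix ι ι ℂ} (h : TraceBound b X) (hbc : b ≤ c) :
    TraceBound c X := by
  obtain ⟨P, Q, hP, hQ, hX, hb⟩ := h
  exact ⟨P, Q, hP, hQ, hX, hb.trans hbc⟩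

theorem zero : TraceBound 0 (0 : Matrix ι ι ℂ) :=
  ⟨0, 0, .zero, .zero, by simp, by simp⟩

theorem add {b c : ℝ} {X Y : Matrix ι ι ℂ} (hX : TraceBound b X) (hY : TraceBound c Y) :
    TraceBound (b + c) (X + Y) := by
  obtain ⟨P, Q, hP, hQ, rfl, hb⟩ := hX
  obtain ⟨R, S, hR, hS, rfl, hc⟩ := hY
  refine ⟨P + R, Q + S, hP.add hR, hQ.add hS, by abel, ?_⟩
  simp only [Matrix.trace_add, Complex.add_re] at *
  linarith

theorem sum {κ : Type*} (s : Finset κ) {b : κ → ℝ} {X : κ → Matrix ι ι ℂ}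
    (h : ∀ k ∈ s, TraceBound (b k) (X k)) : TraceBound (∑ k ∈ s, b k) (∑ k ∈ s, X k) := by
  classical
  induction s using Finset.induction_on with
  | empty => simpa using TraceBound.zero
  | insert k s hk ih =>
    rw [Finset.sum_insert hk, Finset.sum_insert hk]
    exact (h k (by simp)).add (ih fun j hj => h j (by simp [hj]))

theorem smul {b : ℝ} {X : Matrix ι ι ℂ} (h : TraceBound b X) {t : ℝ} (ht : 0 ≤ t) :
    TraceBound (t * b) ((t : ℂ) • X) := by
  obtain ⟨P, Q, hP, hQ, rfl, hb⟩ := h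
  have ht' : (0 : ℂ) ≤ t := by exact_mod_cast ht
  refine ⟨(t : ℂ) • P, (t : ℂ) • Q, hP.smul ht', hQ.smul ht', smul_sub _ _ _, ?_⟩
  rw [Matrix.trace_smul, Matrix.trace_smul, ← smul_add, smul_eq_mul, Complex.re_ofReal_mul]
  exact mul_le_mul_of_nonneg_left hb ht

theorem sub_of_isState {X Y : Matrix ι ι ℂ} (hX : IsState X) (hY : IsState Y) :
    TraceBound 2 (X - Y) :=
  ⟨X, Y, hX.1, hY.1, rfl, by rw [hX.2, hY.2]; norm_num⟩

theorem map {κ : Type} [Fintype κ] {b : ℝ} {X : Matrix ι ι ℂ} (h : TraceBound b X)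
    {Λ : Matrix ι ι ℂ → Matrix κ κ ℂ} (hsub : ∀ X Y, Λ (X - Y) = Λ X - Λ Y)
    (hpos : ∀ X, X.PosSemidef → (Λ X).PosSemidef) (htr : ∀ X, (Λ X).trace = X.trace) :
    TraceBound b (Λ X) := by
  obtain ⟨P, Q, hP, hQ, rfl, hb⟩ := h
  exact ⟨Λ P, Λ Q, hpos P hP, hpos Q hQ, hsub P Q, by rwa [htr, htr]⟩

theorem average_sub {κ : Type*} [Fintype κ] [Nonempty κ] {b : ℝ} {X : κ → Matrix ι ι ℂ}
    {Y : Matrix ι ι ℂ} (h : TraceBound b (∑ k, (X k - Y))) :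
    TraceBound ((Fintype.card κ : ℝ)⁻¹ * b) ((Fintype.card κ : ℂ)⁻¹ • ∑ k, X k - Y) := by
  have hcard : (Fintype.card κ : ℂ) ≠ 0 := Nat.cast_ne_zero.2 Fintype.card_ne_zero
  have hX : (Fintype.card κ : ℂ)⁻¹ • ∑ k, X k - Y =
      ((Fintype.card κ : ℝ)⁻¹ : ℝ) • ∑ k, (X k - Y) := by
    rw [Finset.sum_sub_distrib, Finset.sum_const, Finset.card_univ, ← Nat.cast_smul_eq_nsmul ℂ,
      ← Complex.coe_smul, Complex.ofReal_inv, Complex.ofReal_natCast, smul_sub,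
      inv_smul_smul₀ hcard]
  rw [hX]
  exact h.smul (inv_nonneg.2 (Nat.cast_nonneg _))

end TraceBound

open scoped MatrixOrder in
theorem trace_mul_re_nonneg {A P : Matrix ι ι ℂ} (hA : A.PosSemidef) (hP : P.PosSemidef) :
    0 ≤ (A * P).trace.re := by
  classical
  obtain ⟨B, rfl⟩ := CStarAlgebra.nonneg_iff_eq_star_mul_self.1 hP.nonneg
  rw [Matrix.star_eq_conjTranspose, ← Matrix.mul_assoc, Matrix.trace_mul_comm, ← Matrix.mul_assoc]
  exact (Complex.le_def.1 (hA.mul_mul_conjTranspose_same B).trace_nonneg).1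

variable [DecidableEq ι]

open scoped MatrixOrder in
theorem exists_traceNorm_eq_re_trace_mul {X : Matrix ι ι ℂ} (hX : X.IsHermitian) :
    ∃ S : Matrix ι ι ℂ, (1 - S).PosSemidef ∧ (1 + S).PosSemidef ∧
      traceNorm X = (S * X).trace.re := by
  have hX' : IsSelfAdjoint X := hX
  have hcont (f : ℝ → ℝ) : ContinuousOn f (spectrum ℝ X) :=
    (Matrix.finite_real_spectrum (A := X)).continuousOn f
  let sign : ℝ → ℝ := fun x => SignType.sign x
  refine ⟨cfc sign X, ?_, ?_, ?_⟩
  · rw [← Matrix.le_iff]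
    refine cfc_le_one sign X fun x _ => ?_
    rcases lt_trichotomy x 0 with h | h | h <;> simp [sign, h]
  · rw [← sub_neg_eq_add, ← Matrix.le_iff, ← cfc_neg]
    refine cfc_le_one (fun x => -sign x) X fun x _ => ?_
    rcases lt_trichotomy x 0 with h | h | h <;> simp [sign, h]
  · have habs : CFC.sqrt (Xᴴ * X) = cfc sign X * X := by
      calc CFC.sqrt (Xᴴ * X) = cfc (fun x : ℝ => ‖x‖) X := CFC.abs_eq_cfc_norm X
        _ = cfc (fun x => sign x * id x) X := cfc_congr fun x _ => (sign_mul_self x).symm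
        _ = cfc sign X * X := by rw [cfc_mul sign id X (hcont _) (hcont _), cfc_id ℝ X]
    rw [traceNorm, habs]

namespace TraceBound

open scoped MatrixOrder in
theorem of_traceNorm {X : Matrix ι ι ℂ} (hX : X.IsHermitian) :
    TraceBound (traceNorm X) X := by
  have hX' : IsSelfAdjoint X := hX
  refine ⟨X⁺, X⁻, Matrix.nonneg_iff_posSemidef.1 (CFC.posPart_nonneg X),
    Matrix.nonneg_iff_posSemidef.1 (CFC.negPart_nonneg X),
    (CFC.posPart_sub_negPart X).symm, ?_⟩
  rw [← Matrix.trace_add, CFC.posPart_add_negPart X]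
  rfl

theorem traceNorm_le {b : ℝ} {X : Matrix ι ι ℂ} (hX : TraceBound b X) : traceNorm X ≤ b := by
  obtain ⟨P, Q, hP, hQ, rfl, hb⟩ := hX
  obtain ⟨S, hS, hS', htr⟩ := exists_traceNorm_eq_re_trace_mul (hP.1.sub hQ.1)
  have hSP := trace_mul_re_nonneg hS hP
  have hSQ := trace_mul_re_nonneg hS' hQ
  rw [Matrix.sub_mul, Matrix.one_mul, Matrix.trace_sub, Complex.sub_re] at hSP
  rw [Matrix.add_mul, Matrix.one_mul, Matrix.trace_add, Complex.add_re] at hSQ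
  rw [Complex.add_re] at hb
  rw [htr, Matrix.mul_sub, Matrix.trace_sub, Complex.sub_re]
  linarith

end TraceBound

end TraceNorm

section TensorProduct

section

variable {ι : Type*} [Fintype ι] {d e f : ι → Type*}

/-- The tensor product `⨂ i, A i` of a finite family of operators. With the parties as index type
this is `localProd`; the other index types are needed for the qubits held by a single party. -/
def piTensor (A : ∀ i, Matrix (e i) (d i) ℂ) : Matrix (∀ i, e i) (∀ i, d i) ℂ :=
  Matrix.of fun y x => ∏ i, A i (y i) (x i)

theorem piTensor_apply (A : ∀ i, Matrix (e i) (d i) ℂ) (y : ∀ i, e i) (x : ∀ i, d i) :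
    piTensor A y x = ∏ i, A i (y i) (x i) := rfl

theorem piTensor_one [∀ i, DecidableEq (d i)] :
    piTensor (fun i => (1 : Matrix (d i) (d i) ℂ)) = 1 := by
  ext y x
  simp only [piTensor_apply, Matrix.one_apply, Finset.prod_ite_zero, funext_iff]
  simp

theorem piTensor_smul (w : ι → ℂ) (A : ∀ i, Matrix (e i) (d i) ℂ) :
    (piTensor fun i => w i • A i) = (∏ i, w i) • piTensor A := by
  ext y x
  exact Finset.prod_mul_distrib

theorem piTensor_conjTranspose (A : ∀ i, Matrix (e i) (d i) ℂ) :
    (piTensor A)ᴴ = piTensor fun i => (A i)ᴴ := by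
  ext y x
  simp [piTensor_apply, Matrix.conjTranspose_apply]

variable [DecidableEq ι]

theorem piTensor_mul [∀ i, Fintype (e i)] (A : ∀ i, Matrix (f i) (e i) ℂ)
    (B : ∀ i, Matrix (e i) (d i) ℂ) : piTensor A * piTensor B = piTensor fun i => A i * B i := by
  ext y x
  simp only [piTensor_apply, Matrix.mul_apply, Finset.prod_univ_sum, Fintype.piFinset_univ,
    Finset.prod_mul_distrib]

theorem sum_piTensor {κ : ι → Type*} [∀ i, Fintype (κ i)] (A : ∀ i, κ i → Matrix (e i) (d i) ℂ) :
    ∑ k : ∀ i, κ i, piTensor (fun i => A i (k i)) = piTensor fun i => ∑ j, A i j := by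
  ext y x
  simp only [Matrix.sum_apply, piTensor_apply, Finset.prod_univ_sum, Fintype.piFinset_univ]

end

variable {N : ℕ} {d e f : Fin N → Type}

theorem localProd_apply (A : ∀ p, Matrix (e p) (d p) ℂ) (y : ∀ p, e p) (x : ∀ p, d p) :
    localProd A y x = ∏ p, A p (y p) (x p) := rfl

theorem localProd_mul [∀ p, Fintype (e p)] (A : ∀ p, Matrix (f p) (e p) ℂ)
    (B : ∀ p, Matrix (e p) (d p) ℂ) : localProd A * localProd B = localProd fun p => A p * B p :=
  piTensor_mul A B

theorem localProd_one [∀ p, DecidableEq (d p)] :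
    localProd (fun p => (1 : Matrix (d p) (d p) ℂ)) = 1 :=
  piTensor_one

theorem localProd_conjTranspose (A : ∀ p, Matrix (e p) (d p) ℂ) :
    (localProd A)ᴴ = localProd fun p => (A p)ᴴ :=
  piTensor_conjTranspose A

theorem sum_localProd {κ : Fin N → Type} [∀ p, Fintype (κ p)]
    (A : ∀ p, κ p → Matrix (e p) (d p) ℂ) :
    ∑ k : ∀ p, κ p, localProd (fun p => A p (k p)) = localProd fun p => ∑ j, A p j :=
  sum_piTensor A

theorem sum_localProd_conjTranspose_mul_self [∀ p, DecidableEq (d p)]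
    {κ : Fin N → Type} [∀ p, Fintype (κ p)] {d' : ∀ p, κ p → Type} [∀ p j, Fintype (d' p j)]
    (A : ∀ p j, Matrix (d' p j) (d p) ℂ) (hA : ∀ p, ∑ j, (A p j)ᴴ * A p j = 1) :
    ∑ k : ∀ p, κ p, (localProd fun p => A p (k p))ᴴ * (localProd fun p => A p (k p)) = 1 := by
  simp only [localProd_conjTranspose, localProd_mul]
  rw [sum_localProd fun p j => (A p j)ᴴ * A p j]
  simp only [hA, localProd_one]

end TensorProduct

section SubmatrixOne

theorem one_submatrix_mul_mul_conjTranspose {α ι : Type*} [Fintype ι] [DecidableEq ι]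
    (g : α → ι) (X : Matrix ι ι ℂ) :
    (1 : Matrix ι ι ℂ).submatrix g id * X * ((1 : Matrix ι ι ℂ).submatrix g id)ᴴ =
      X.submatrix g g := by
  rw [Matrix.conjTranspose_submatrix, Matrix.conjTranspose_one]
  have h := Matrix.submatrix_mul (1 * X) 1 g id g Function.bijective_id
  rwa [Matrix.submatrix_mul 1 X g id id Function.bijective_id, Matrix.mul_one, Matrix.one_mul,
    Matrix.submatrix_id_id, eq_comm] at h

theorem sum_one_submatrix_conjTranspose_mul_self {κ ι : Type*} {α : κ → Type*} [Fintype κ]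
    [∀ j, Fintype (α j)] [DecidableEq ι] (s : (Σ j, α j) ≃ ι) :
    ∑ j, ((1 : Matrix ι ι ℂ).submatrix (fun a => s ⟨j, a⟩) id)ᴴ *
      (1 : Matrix ι ι ℂ).submatrix (fun a => s ⟨j, a⟩) id = 1 := by
  classical
  ext x y
  calc (∑ j, ((1 : Matrix ι ι ℂ).submatrix (fun a => s ⟨j, a⟩) id)ᴴ *
        (1 : Matrix ι ι ℂ).submatrix (fun a => s ⟨j, a⟩) id) x y
      = ∑ b, star ((1 : Matrix ι ι ℂ) (s b) x) * (1 : Matrix ι ι ℂ) (s b) y := by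
        rw [Fintype.sum_sigma, Matrix.sum_apply]
        rfl
    _ = (1 : Matrix ι ι ℂ) x y := by
        simp [Matrix.one_apply, ← Equiv.eq_symm_apply, eq_comm (a := y)]

end SubmatrixOne

section Basic

variable {N : ℕ} {d e f : Fin N → Type} [∀ p, Fintype (d p)] [∀ p, DecidableEq (d p)]
  [∀ p, Fintype (e p)] [∀ p, DecidableEq (e p)] [∀ p, Fintype (f p)] [∀ p, DecidableEq (f p)]

namespace IsLOCC

theorem isLinearMap {Λ : Op d → Op e} (h : IsLOCC Λ) : IsLinearMap ℂ Λ := by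
  induction h with
  | done => exact ⟨fun _ _ => rfl, fun _ _ => rfl⟩
  | round _ _ _ _ Λ _ ih =>
    constructor
    · intro X Y
      rw [← Finset.sum_add_distrib]
      refine Finset.sum_congr rfl fun k _ => ?_
      rw [← (ih k).map_add, Matrix.mul_add, Matrix.add_mul]
    · intro c X
      rw [Finset.smul_sum]
      refine Finset.sum_congr rfl fun k _ => ?_
      rw [← (ih k).map_smul, Matrix.mul_smul, Matrix.smul_mul]

theorem map_sum {Λ : Op d → Op e} (h : IsLOCC Λ) {κ : Type*} (s : Finset κ)
    (X : κ → Op d) : Λ (∑ k ∈ s, X k) = ∑ k ∈ s, Λ (X k) :=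
  _root_.map_sum (IsLinearMap.mk' Λ h.isLinearMap) X s

theorem posSemidef {Λ : Op d → Op e} (h : IsLOCC Λ) {X : Op d} (hX : X.PosSemidef) :
    (Λ X).PosSemidef := by
  induction h with
  | done => exact hX
  | round _ _ _ _ _ _ ih =>
    exact Matrix.posSemidef_sum _ fun k _ => ih k (hX.mul_mul_conjTranspose_same _)

theorem trace {Λ : Op d → Op e} (h : IsLOCC Λ) (X : Op d) : (Λ X).trace = X.trace := by
  induction h with
  | done => rfl
  | round _ _ A hA Λ _ ih =>
    conv_rhs => rw [← Matrix.one_mul X, ← sum_localProd_conjTranspose_mul_self A hA,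
      Finset.sum_mul, Matrix.trace_sum]
    rw [Matrix.trace_sum]
    refine Finset.sum_congr rfl fun k _ => ?_
    rw [ih, Matrix.trace_mul_comm, ← Matrix.mul_assoc]

theorem isState {Λ : Op d → Op e} (h : IsLOCC Λ) {X : Op d} (hX : IsState X) :
    IsState (Λ X) :=
  ⟨h.posSemidef hX.1, by rw [h.trace, hX.2]⟩

theorem traceBound {Λ : Op d → Op e} (h : IsLOCC Λ) {X : Op d} {b : ℝ}
    (hX : TraceBound b X) : TraceBound b (Λ X) :=
  hX.map (fun _ _ => h.isLinearMap.map_sub _ _) (fun _ => h.posSemidef) h.trace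

theorem comp {Λ : Op d → Op e} (h : IsLOCC Λ) {Γ : Op e → Op f} (hΓ : IsLOCC Γ) :
    IsLOCC (fun X => Γ (Λ X)) := by
  induction h with
  | done => exact hΓ
  | round κ d' A hA Λ _ ih =>
    convert IsLOCC.round κ d' A hA (fun k X => Γ (Λ k X)) ih using 1
    funext X
    exact hΓ.map_sum _ _

/-- Each party measures the block of its basis, split as `Σ j, d' p j`, in which its system lies. -/
theorem measure {κ : Fin N → Type} [∀ p, Fintype (κ p)] {d' : ∀ p, κ p → Type}
    [∀ p j, Fintype (d' p j)] [∀ p j, DecidableEq (d' p j)]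
    (s : ∀ p, (Σ j, d' p j) ≃ d p)
    {Λ : ∀ k : ∀ p, κ p, Op (fun p => d' p (k p)) → Op e} (hΛ : ∀ k, IsLOCC (Λ k)) :
    IsLOCC fun X : Op d => ∑ k, Λ k (X.submatrix (fun a p => s p ⟨k p, a p⟩)
      (fun a p => s p ⟨k p, a p⟩)) := by
  let A p j : Matrix (d' p j) (d p) ℂ :=
    (1 : Matrix (d p) (d p) ℂ).submatrix (fun a => s p ⟨j, a⟩) id
  have hA p : ∑ j, (A p j)ᴴ * A p j = 1 := sum_one_submatrix_conjTranspose_mul_self (s p)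
  convert IsLOCC.round κ d' A hA Λ hΛ using 1
  funext X
  refine Finset.sum_congr rfl fun k _ => congrArg (Λ k) ?_
  have hk : localProd (fun p => A p (k p)) =
      (1 : Op d).submatrix (fun a p => s p ⟨k p, a p⟩) id := by
    rw [← localProd_one]
    rfl
  rw [hk, one_submatrix_mul_mul_conjTranspose]

theorem conj_localProd {A : ∀ p, Matrix (e p) (d p) ℂ} (hA : ∀ p, (A p)ᴴ * A p = 1) :
    IsLOCC fun X : Op d => localProd A * X * (localProd A)ᴴ := by
  convert IsLOCC.round (fun _ => Unit) (fun p _ => e p) (fun p _ => A p) (fun p => ?_)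
    (fun _ X => X) fun _ => .done using 1
  · funext X
    rw [Fintype.sum_unique]
  · rw [Fintype.sum_unique, hA]

end IsLOCC

end Basic

section Embed

variable {N : ℕ} {d e : Fin N → Type} [∀ p, DecidableEq (e p)]

/-- The isometry that maps local basis vectors as `f` does. -/
def basisMap (f : ∀ p, d p → e p) : Matrix (∀ p, e p) (∀ p, d p) ℂ :=
  (1 : Op e).submatrix id fun x p => f p (x p)

theorem basisMap_eq_localProd (f : ∀ p, d p → e p) :
    basisMap f = localProd fun p => (1 : Matrix (e p) (e p) ℂ).submatrix id (f p) := by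
  rw [basisMap, ← localProd_one]
  rfl

variable [∀ p, Fintype (d p)]

/-- The local operation that maps basis vectors as `f` does. -/
def embed (f : ∀ p, d p → e p) (X : Op d) : Op e := basisMap f * X * (basisMap f)ᴴ

theorem embed_submatrix {f : ∀ p, d p → e p} (hf : ∀ p, (f p).Injective) (X : Op d) :
    (embed f X).submatrix (fun x p => f p (x p)) (fun x p => f p (x p)) = X := by
  classical
  have hinj {x y : ∀ p, d p} : (fun p => f p (x p)) = (fun p => f p (y p)) ↔ x = y := by
    simp only [funext_iff, (hf _).eq_iff]
  ext x y
  simp [embed, basisMap, Matrix.mul_apply, Matrix.one_apply, hinj]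

theorem embed_apply_of_ne {f : ∀ p, d p → e p} (X : Op d) {y : ∀ p, e p}
    (hy : ∀ x : ∀ p, d p, y ≠ fun p => f p (x p)) (z : ∀ p, e p) : embed f X y z = 0 := by
  simp [embed, basisMap, Matrix.mul_apply, hy]

variable [∀ p, Fintype (e p)]

theorem embed_embed {f : Fin N → Type} [∀ p, DecidableEq (f p)] (g : ∀ p, e p → f p)
    (h : ∀ p, d p → e p) (X : Op d) : embed g (embed h X) = embed (fun p => g p ∘ h p) X := by
  have hmul : basisMap g * basisMap h = basisMap fun p => g p ∘ h p := by
    ext y x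
    simp [basisMap, Matrix.mul_apply, Matrix.one_apply]
  rw [embed, embed, embed, ← hmul, Matrix.conjTranspose_mul]
  simp only [Matrix.mul_assoc]

variable [∀ p, DecidableEq (d p)]

theorem IsLOCC.embed {f : ∀ p, d p → e p} (hf : ∀ p, (f p).Injective) : IsLOCC (embed f) := by
  have hembed : QEnt.embed f = fun X => localProd
      (fun p => (1 : Matrix (e p) (e p) ℂ).submatrix id (f p)) * X *
        (localProd fun p => (1 : Matrix (e p) (e p) ℂ).submatrix id (f p))ᴴ := by
    rw [← basisMap_eq_localProd]
    rfl
  rw [hembed]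
  refine IsLOCC.conj_localProd fun p => ?_
  rw [Matrix.conjTranspose_submatrix, Matrix.conjTranspose_one,
    ← Matrix.submatrix_mul 1 1 (f p) id (f p) Function.bijective_id, Matrix.one_mul,
    Matrix.submatrix_one _ (hf p)]

theorem IsLOCC.reindex (f : ∀ p, e p ≃ d p) :
    IsLOCC (fun X : Op d => X.submatrix (fun y p => f p (y p)) (fun y p => f p (y p))) := by
  convert IsLOCC.measure (κ := fun _ => Unit)
    (fun p => (Equiv.uniqueSigma fun _ => e p).trans (f p)) fun _ => IsLOCC.done (e := e) using 1
  funext X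
  symm
  exact Fintype.sum_unique (ι := Fin N → Unit) _

end Embed

section Joint

variable {N : ℕ} {d e c : Fin N → Type}

/-- Exchange of the two parts of a joint system. -/
def swap (X : Op (Joint d c)) : Op (Joint c d) :=
  X.submatrix (fun y p => ((y p).2, (y p).1)) (fun y p => ((y p).2, (y p).1))

/-- The block of an operator on a joint system between two basis vectors of the second part. -/
def slice (X : Op (Joint d c)) (z w : ∀ p, c p) : Op d :=
  X.submatrix (fun a p => (a p, z p)) (fun b p => (b p, w p))

/-- The operation `Λ ⊗ id` on a joint system. -/
def ampl (c : Fin N → Type) (Λ : Op d → Op e) (X : Op (Joint d c)) : Op (Joint e c) :=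
  Matrix.of fun x y => Λ (slice X (fun p => (x p).2) fun p => (y p).2)
    (fun p => (x p).1) (fun p => (y p).1)

theorem isLinearMap_tensor (ρ : Op d) : IsLinearMap ℂ (tensor (c := c) ρ) :=
  ⟨fun _ _ => Matrix.ext fun _ _ => mul_add _ _ _,
    fun _ _ => Matrix.ext fun _ _ => mul_left_comm _ _ _⟩

theorem slice_tensor (ρ : Op d) (τ : Op c) (z w : ∀ p, c p) :
    slice (tensor ρ τ) z w = τ z w • ρ := by
  ext a b
  exact mul_comm _ _

theorem ampl_tensor {Λ : Op d → Op e} (h : IsLinearMap ℂ Λ) (ρ : Op d) (τ : Op c) :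
    ampl c Λ (tensor ρ τ) = tensor (Λ ρ) τ := by
  ext x y
  rw [ampl, Matrix.of_apply, slice_tensor, h.map_smul, Matrix.smul_apply, smul_eq_mul, mul_comm]
  rfl

theorem swap_tensor (ρ : Op d) (τ : Op c) : swap (tensor ρ τ) = tensor τ ρ := by
  ext x y
  exact mul_comm _ _

section

variable [∀ p, Fintype (c p)]

theorem marginalS_eq_sum_slice (X : Op (Joint d c)) : marginalS X = ∑ z, slice X z z := by
  ext x y
  rw [Matrix.sum_apply]
  rfl

theorem marginalS_ampl {Λ : Op d → Op e} (h : IsLinearMap ℂ Λ) (X : Op (Joint d c)) :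
    marginalS (ampl c Λ X) = Λ (marginalS X) := by
  rw [marginalS_eq_sum_slice, marginalS_eq_sum_slice]
  exact (map_sum (IsLinearMap.mk' Λ h) (fun z => slice X z z) Finset.univ).symm

theorem marginalS_tensor (ρ : Op d) (τ : Op c) : marginalS (tensor ρ τ) = τ.trace • ρ := by
  rw [marginalS_eq_sum_slice, Matrix.trace, Finset.sum_smul]
  exact Finset.sum_congr rfl fun z _ => slice_tensor ρ τ z z

theorem marginalC_swap (X : Op (Joint d c)) : marginalC (swap X) = marginalS X := rfl

end

variable [∀ p, Fintype (d p)]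

theorem marginalS_swap (X : Op (Joint d c)) : marginalS (swap X) = marginalC X := rfl

theorem marginalC_apply (X : Op (Joint d c)) (z w : ∀ p, c p) :
    marginalC X z w = (slice X z w).trace := rfl

theorem sum_joint {M : Type*} [AddCommMonoid M] [∀ p, Fintype (c p)]
    (F : (∀ p, Joint d c p) → M) :
    ∑ x, F x = ∑ a : ∀ p, d p, ∑ b : ∀ p, c p, F fun p => (a p, b p) := by
  rw [← Fintype.sum_prod_type', ← (Equiv.arrowProdEquivProdArrow (Fin N) d c).symm.sum_comp]
  rfl

theorem trace_tensor [∀ p, Fintype (c p)] (ρ : Op d) (τ : Op c) :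
    (tensor ρ τ).trace = ρ.trace * τ.trace := by
  simp only [Matrix.trace, sum_joint, Finset.sum_mul_sum]
  rfl

open scoped Kronecker in
theorem slice_conj_localProd_kronecker_one [∀ p, Fintype (c p)] [∀ p, DecidableEq (c p)]
    (A : ∀ p, Matrix (e p) (d p) ℂ) (X : Op (Joint d c)) (z w : ∀ p, c p) :
    slice (localProd (fun p => A p ⊗ₖ (1 : Matrix (c p) (c p) ℂ)) * X *
      (localProd (fun p => A p ⊗ₖ (1 : Matrix (c p) (c p) ℂ)))ᴴ) z w =
      localProd A * slice X z w * (localProd A)ᴴ := by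
  have hA (a : ∀ p, e p) (z : ∀ p, c p) (b : ∀ p, d p) (w : ∀ p, c p) :
      localProd (fun p => A p ⊗ₖ (1 : Matrix (c p) (c p) ℂ)) (fun p => (a p, z p))
        (fun p => (b p, w p)) = localProd A a b * (1 : Op c) z w := by
    rw [← localProd_one, localProd_apply, localProd_apply, localProd_apply,
      ← Finset.prod_mul_distrib]
    rfl
  ext a b
  simp [slice, Matrix.mul_apply, hA, sum_joint, Finset.sum_mul, Matrix.one_apply,
    apply_ite (starRingEnd ℂ)]

variable [∀ p, DecidableEq (d p)] [∀ p, Fintype (e p)] [∀ p, DecidableEq (e p)]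

theorem marginalC_ampl {Λ : Op d → Op e} (h : IsLOCC Λ) (X : Op (Joint d c)) :
    marginalC (ampl c Λ X) = marginalC X := by
  ext z w
  rw [marginalC_apply, marginalC_apply, ← h.trace]
  rfl

variable [∀ p, Fintype (c p)] [∀ p, DecidableEq (c p)]

namespace IsLOCC

open scoped Kronecker in
theorem ampl {Λ : Op d → Op e} (h : IsLOCC Λ) (c : Fin N → Type) [∀ p, Fintype (c p)]
    [∀ p, DecidableEq (c p)] : IsLOCC (ampl c Λ) := by
  induction h with
  | done => exact IsLOCC.done
  | round κ d' A hA Λ _ ih =>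
    convert IsLOCC.round (d := Joint _ c) (e := Joint e c) κ (fun p j => d' p j × c p)
      (fun p j => A p j ⊗ₖ (1 : Matrix (c p) (c p) ℂ)) (fun p => ?_)
      (fun k => QEnt.ampl c (Λ k)) ih using 1
    · funext X
      ext x y
      simp only [QEnt.ampl, Matrix.of_apply, Matrix.sum_apply, slice_conj_localProd_kronecker_one]
    · simp only [Matrix.conjTranspose_kronecker, ← Matrix.mul_kronecker_mul,
        Matrix.conjTranspose_one, Matrix.mul_one]
      rw [← Matrix.one_kronecker_one, ← hA]
      ext x y
      simp only [Matrix.sum_apply, Matrix.kroneckerMap_apply, Finset.sum_mul]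

theorem marginalS : IsLOCC (marginalS : Op (Joint d c) → Op d) := by
  convert IsLOCC.measure (d := Joint d c)
    (fun p => (Equiv.sigmaEquivProd (c p) (d p)).trans (Equiv.prodComm (c p) (d p)))
    fun _ => IsLOCC.done (e := d) using 1
  funext X
  exact marginalS_eq_sum_slice X

theorem swap : IsLOCC (swap : Op (Joint d c) → Op (Joint c d)) :=
  IsLOCC.reindex (d := Joint d c) (e := Joint c d) fun p => Equiv.prodComm (c p) (d p)

theorem marginalC : IsLOCC (marginalC : Op (Joint d c) → Op c) :=
  IsLOCC.swap.comp IsLOCC.marginalS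

end IsLOCC

/-- Appending a product basis state `a` as the first part of a joint system. -/
def prepend (a : ∀ p, d p) : Op c → Op (Joint d c) := embed fun p z => (a p, z)

theorem IsLOCC.prepend (a : ∀ p, d p) : IsLOCC (prepend a : Op c → Op (Joint d c)) :=
  IsLOCC.embed fun p => Prod.mk_right_injective (a p)

theorem marginalC_prepend (a : ∀ p, d p) (X : Op c) : marginalC (prepend a X) = X := by
  have hinj (p) : (fun z : c p => (a p, z)).Injective := Prod.mk_right_injective (a p)
  ext z w
  calc marginalC (prepend a X) z w
      = prepend a X (fun p => (a p, z p)) (fun p => (a p, w p)) :=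
        Fintype.sum_eq_single a fun x hx => embed_apply_of_ne X (fun y hy =>
          hx (funext fun p => congrArg Prod.fst (congrFun hy p))) _
    _ = X z w := congrFun₂ (embed_submatrix hinj X) z w

theorem IsLOCC.exists_of_nonempty (d e : Fin N → Type) [∀ p, Fintype (d p)]
    [∀ p, DecidableEq (d p)] [∀ p, Fintype (e p)] [∀ p, DecidableEq (e p)]
    [∀ p, Nonempty (e p)] : ∃ Λ : Op d → Op e, IsLOCC Λ :=
  ⟨_, (IsLOCC.prepend fun p => Classical.arbitrary (e p)).comp IsLOCC.marginalS⟩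

end Joint

section Copies

variable {N : ℕ} {d : Fin N → Type} {n : ℕ}

/-- Adjoining one further copy of a system in front of `n` copies. -/
def consCopy (X : Op (Joint d (Copies d n))) : Op (Copies d (n + 1)) :=
  X.submatrix (fun x p => (x p 0, Fin.tail (x p))) (fun x p => (x p 0, Fin.tail (x p)))

/-- Splitting off the first copy of a system. -/
def unconsCopy (X : Op (Copies d (n + 1))) : Op (Joint d (Copies d n)) :=
  X.submatrix (fun x p => Fin.cons (x p).1 (x p).2) (fun x p => Fin.cons (x p).1 (x p).2)

theorem unconsCopy_consCopy (X : Op (Joint d (Copies d n))) : unconsCopy (consCopy X) = X := rfl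

theorem consCopy_tensor_power (ρ : Op d) (n : ℕ) :
    consCopy (tensor ρ (power ρ n)) = power ρ (n + 1) := by
  ext x y
  exact (Fin.prod_univ_succ fun i => ρ (fun p => x p i) fun p => y p i).symm

theorem power_zero (ρ : Op d) : power ρ 0 = 1 := by
  ext x y
  rw [Subsingleton.elim x y, Matrix.one_apply_eq]
  rfl

variable [∀ p, Fintype (d p)]

theorem sum_copies_succ {M : Type*} [AddCommMonoid M] (F : (∀ p, Copies d (n + 1) p) → M) :
    ∑ u, F u = ∑ a : ∀ p, d p, ∑ b : ∀ p, Copies d n p, F fun p => Fin.cons (a p) (b p) := by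
  rw [← sum_joint (d := d) (c := Copies d n) fun x => F fun p => Fin.cons (x p).1 (x p).2]
  exact (Equiv.sum_comp (Equiv.piCongrRight fun p => Fin.consEquiv fun _ => d p) F).symm

/-- The reduced operator on the last `b` of `n` copies. -/
noncomputable def lastCopies {b : ℕ} (hb : b ≤ n) (μ : Op (Copies d n)) : Op (Copies d b) :=
  Nat.decreasingInduction (motive := fun b _ => Op (Copies d b))
    (fun _ _ X => marginalC (unconsCopy X)) μ hb

theorem lastCopies_self (μ : Op (Copies d n)) : lastCopies le_rfl μ = μ :=
  Nat.decreasingInduction_self ..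

theorem lastCopies_eq_marginalC {b : ℕ} (hb : b + 1 ≤ n) (μ : Op (Copies d n)) :
    lastCopies (Nat.le_of_succ_le hb) μ = marginalC (unconsCopy (lastCopies hb μ)) :=
  Nat.decreasingInduction_succ_left ..

variable [∀ p, DecidableEq (d p)]

theorem copyMarginal_zero (X : Op (Copies d (n + 1))) :
    copyMarginal 0 X = marginalS (unconsCopy X) := by
  ext x y
  simp [copyMarginal, Finset.sum_filter, sum_copies_succ, marginalS, unconsCopy]

theorem copyMarginal_succ (X : Op (Copies d (n + 1))) (i : Fin n) :
    copyMarginal i.succ X = copyMarginal i (marginalC (unconsCopy X)) := by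
  ext x y
  simp only [copyMarginal, Matrix.of_apply, Finset.sum_filter, sum_copies_succ]
  rw [Finset.sum_comm]
  refine Finset.sum_congr rfl fun u _ => ?_
  simp [marginalC, unconsCopy, ← Fin.cons_update]

namespace IsLOCC

theorem consCopy : IsLOCC (consCopy : Op (Joint d (Copies d n)) → Op (Copies d (n + 1))) :=
  IsLOCC.reindex (d := Joint d (Copies d n)) (e := Copies d (n + 1))
    fun p => (Fin.consEquiv fun _ => d p).symm

theorem unconsCopy : IsLOCC (unconsCopy : Op (Copies d (n + 1)) → Op (Joint d (Copies d n))) :=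
  IsLOCC.reindex (e := Joint d (Copies d n)) (d := Copies d (n + 1))
    fun p => Fin.consEquiv fun _ => d p

theorem copyMarginal (i : Fin n) : IsLOCC (copyMarginal i : Op (Copies d n) → Op d) := by
  induction n with
  | zero => exact i.elim0
  | succ n ih =>
    cases i using Fin.cases with
    | zero =>
      rw [funext copyMarginal_zero]
      exact IsLOCC.unconsCopy.comp .marginalS
    | succ i =>
      rw [show (QEnt.copyMarginal i.succ : Op (Copies d (n + 1)) → Op d) = _ from
        funext (copyMarginal_succ · i)]
      exact (IsLOCC.unconsCopy.comp .marginalC).comp (ih i)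

end IsLOCC

theorem copyMarginal_lastCopies {b : ℕ} (hb : b ≤ n) (μ : Op (Copies d n)) (i : Fin b) :
    copyMarginal i (lastCopies hb μ) = copyMarginal ⟨n - b + i, by omega⟩ μ := by
  induction hb using Nat.decreasingInduction with
  | self => simp [lastCopies_self]
  | of_succ b hb ih =>
    rw [lastCopies_eq_marginalC hb, ← copyMarginal_succ, ih]
    congr 2
    simp only [Fin.val_succ]
    omega

end Copies

section States

theorem isState_average {ι κ : Type} [Fintype ι] [Fintype κ] [Nonempty κ] {X : κ → Matrix ι ι ℂ}
    (hX : ∀ k, IsState (X k)) : IsState ((Fintype.card κ : ℂ)⁻¹ • ∑ k, X k) := by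
  have hcard : (Fintype.card κ : ℂ) ≠ 0 := Nat.cast_ne_zero.2 Fintype.card_ne_zero
  have hcard' : (0 : ℂ) ≤ (Fintype.card κ : ℂ)⁻¹ := by positivity
  refine ⟨(Matrix.posSemidef_sum _ fun k _ => (hX k).1).smul hcard', ?_⟩
  rw [Matrix.trace_smul, Matrix.trace_sum, Finset.sum_congr rfl fun k _ => (hX k).2]
  simp [hcard]

open scoped Kronecker in
theorem posSemidef_tensor {N : ℕ} {d c : Fin N → Type} [∀ p, Finite (d p)] [∀ p, Finite (c p)]
    {ρ : Op d} {τ : Op c} (hρ : ρ.PosSemidef) (hτ : τ.PosSemidef) :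
    (tensor ρ τ).PosSemidef :=
  (hρ.kronecker hτ).submatrix (Equiv.arrowProdEquivProdArrow (Fin N) d c)

variable {N : ℕ} {d c : Fin N → Type} [∀ p, Fintype (d p)]

theorem IsState.nonempty {ρ : Op d} (hρ : IsState ρ) (p : Fin N) : Nonempty (d p) := by
  by_contra h
  have : IsEmpty (∀ p, d p) := ⟨fun x => h ⟨x p⟩⟩
  simpa [Matrix.trace] using hρ.2

variable [∀ p, Fintype (c p)]

theorem IsState.tensor {ρ : Op d} {τ : Op c} (hρ : IsState ρ) (hτ : IsState τ) :
    IsState (tensor ρ τ) :=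
  ⟨posSemidef_tensor hρ.1 hτ.1, by rw [trace_tensor, hρ.2, hτ.2, one_mul]⟩

theorem TraceBound.tensor_right {b : ℝ} {X : Op d} (h : TraceBound b X) {τ : Op c}
    (hτ : IsState τ) : TraceBound b (tensor X τ) := by
  refine h.map (Λ := (QEnt.tensor · τ)) (fun X Y => ?_) (fun X hX => posSemidef_tensor hX hτ.1)
    fun X => by rw [trace_tensor, hτ.2, mul_one]
  ext x y
  exact sub_mul _ _ _

theorem IsState.power {ρ : Op d} (hρ : IsState ρ) (n : ℕ) : IsState (power ρ n) := by
  classical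
  induction n with
  | zero =>
    rw [power_zero]
    exact ⟨.one, by simp⟩
  | succ n ih =>
    rw [← consCopy_tensor_power]
    exact IsLOCC.consCopy.isState (hρ.tensor ih)

theorem IsState.lastCopies {n b : ℕ} (hb : b ≤ n) {μ : Op (Copies d n)} (hμ : IsState μ) :
    IsState (lastCopies hb μ) := by
  classical
  induction hb using Nat.decreasingInduction with
  | self => rwa [lastCopies_self]
  | of_succ b hb ih =>
    rw [lastCopies_eq_marginalC hb]
    exact IsLOCC.marginalC.isState (IsLOCC.unconsCopy.isState ih)

end States

section Sectors

theorem exists_dependent_extension {ι κ : Type*} {f : ι → κ} (hf : f.Injective) {β : κ → Type*}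
    {P : ∀ k, β k → Prop} (hP : ∀ k, ∃ b, P k b) {g : ∀ i, β (f i)} (hg : ∀ i, P (f i) (g i)) :
    ∃ G : ∀ k, β k, (∀ k, P k (G k)) ∧ ∀ i, G (f i) = g i := by
  have hex (k) : ∃ b, P k b ∧ ∀ i (h : f i = k), b = h ▸ g i := by
    by_cases hk : ∃ i, f i = k
    · obtain ⟨i, rfl⟩ := hk
      refine ⟨g i, hg i, fun j h => ?_⟩
      obtain rfl := hf h
      rfl
    · obtain ⟨b, hb⟩ := hP k
      exact ⟨b, hb, fun i h => absurd ⟨i, h⟩ hk⟩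
  choose G hG hGg using hex
  exact ⟨G, hG, fun i => hGg (f i) i rfl⟩

variable {N : ℕ} {d : Fin N → Type} {K : Type} {V : K → Fin N → Type}

/-- The local spaces `⨁ k, V k p`: every party holds a classical register `k` together with its
part of the system `V k`. -/
abbrev Sector (V : K → Fin N → Type) : Fin N → Type := fun p => Σ k, V k p

/-- The block of an operator on a joint system in which party `p` reads the register value `k p`. -/
def sectorBlock (k : Fin N → K) (X : Op (Joint d (Sector V))) :
    Op (fun p => d p × V (k p) p) :=
  X.submatrix (fun a p => ((a p).1, ⟨k p, (a p).2⟩)) (fun a p => ((a p).1, ⟨k p, (a p).2⟩))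

variable [DecidableEq K] [∀ k p, Fintype (V k p)] [∀ k p, DecidableEq (V k p)]

/-- The operator `|k⟩⟨k| ⊗ T`. -/
def sector (k : K) (T : Op (V k)) : Op (Sector V) := embed (fun _ => Sigma.mk k) T

theorem sectorBlock_tensor_sector_self (k : K) (ρ : Op d) (T : Op (V k)) :
    sectorBlock (fun _ => k) (tensor ρ (sector k T)) = tensor ρ T := by
  ext x y
  exact congrArg (ρ _ _ * ·)
    (congrFun₂ (embed_submatrix (fun p => sigma_mk_injective (β := (V · p))) T) _ _)

theorem sectorBlock_tensor_sector_of_ne {k : Fin N → K} {k₀ : K} (hk : k ≠ fun _ => k₀)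
    (ρ : Op d) (T : Op (V k₀)) : sectorBlock k (tensor ρ (sector k₀ T)) = 0 := by
  ext x y
  refine mul_eq_zero_of_right _ (embed_apply_of_ne T (fun v hv => hk ?_) _)
  exact funext fun p => congrArg Sigma.fst (congrFun hv p)

variable [Fintype K]

theorem IsLOCC.sector (k : K) : IsLOCC (sector k : Op (V k) → Op (Sector V)) :=
  IsLOCC.embed fun p => sigma_mk_injective (β := (V · p))

variable [∀ p, Fintype (d p)] [∀ p, DecidableEq (d p)]
  {f : Fin N → Type} [∀ p, Fintype (f p)] [∀ p, DecidableEq (f p)]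

theorem IsLOCC.sectorwise {Γ : ∀ k : Fin N → K, Op (fun p => d p × V (k p) p) → Op f}
    (hΓ : ∀ k, IsLOCC (Γ k)) :
    IsLOCC fun X : Op (Joint d (Sector V)) => ∑ k, Γ k (sectorBlock k X) :=
  IsLOCC.measure (d := Joint d (Sector V)) (d' := fun p k => d p × V k p)
    (fun p =>
      { toFun x := (x.2.1, ⟨x.1, x.2.2⟩)
        invFun x := ⟨x.2.1, (x.1, x.2.2)⟩ }) hΓ

/- If the parties read different values of the register, any protocol will do, as this does not
happen in a state that is a mixture of sectors. -/
theorem IsLOCC.exists_sectorwise [NeZero N] [∀ p, Nonempty (f p)]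
    {G : ∀ k, Op (Joint d (V k)) → Op f} (hG : ∀ k, IsLOCC (G k)) :
    ∃ Λ : Op (Joint d (Sector V)) → Op f, IsLOCC Λ ∧
      ∀ (ρ : Op d) (k : K) (T : Op (V k)), Λ (tensor ρ (QEnt.sector k T)) = G k (tensor ρ T) := by
  obtain ⟨Γ, hΓ, hΓG⟩ := exists_dependent_extension
    (β := fun k : Fin N → K => Op (fun p => d p × V (k p) p) → Op f) (P := fun _ => IsLOCC)
    Function.const_injective (fun _ => IsLOCC.exists_of_nonempty _ f) hG
  refine ⟨_, IsLOCC.sectorwise hΓ, fun ρ k T => ?_⟩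
  rw [Finset.sum_eq_single (fun _ => k), sectorBlock_tensor_sector_self]
  · exact congrFun (hΓG k) _
  · intro k' _ hk'
    rw [sectorBlock_tensor_sector_of_ne hk', (hΓ k').isLinearMap.map_zero]
  · exact fun h => absurd (Finset.mem_univ _) h

end Sectors

section CatalystStep

variable {N : ℕ} {d e c c' : Fin N → Type} [∀ p, Fintype (d p)] [∀ p, DecidableEq (d p)]
  [∀ p, Fintype (e p)] [∀ p, DecidableEq (e p)] [∀ p, Fintype (c p)] [∀ p, DecidableEq (c p)]
  [∀ p, Fintype (c' p)] [∀ p, DecidableEq (c' p)]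

/-- With the help of the auxiliary operator `τ`, a protocol turns `ρ` into `η`, and the auxiliary
operator into `τ'`. The output and the new auxiliary operator may be correlated. -/
def CatalystStep (ρ : Op d) (τ : Op c) (η : Op e) (τ' : Op c') : Prop :=
  ∃ Γ : Op (Joint d c) → Op (Joint e c'), IsLOCC Γ ∧
    marginalS (Γ (tensor ρ τ)) = η ∧ marginalC (Γ (tensor ρ τ)) = τ'

/-- `η` is the exact output of a protocol that uses `ρ` and returns a catalyst. -/
def IsCatalyticOutput (ρ : Op d) (η : Op e) : Prop :=
  ∃ (c : Fin N → Type) (_ : ∀ p, Fintype (c p)) (_ : ∀ p, DecidableEq (c p)) (τ : Op c),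
    IsState τ ∧ CatalystStep ρ τ η τ

theorem catalyticallyConvertible_iff {ρ : Op d} {σ : Op e} :
    CatalyticallyConvertible ρ σ ↔
      ∀ ε > 0, ∃ η, IsCatalyticOutput ρ η ∧ traceNorm (η - σ) < ε := by
  refine forall₂_congr fun ε _ => ⟨?_, ?_⟩
  · rintro ⟨c, _, _, τ, Λ, hτ, hΛ, hσ, hC⟩
    exact ⟨_, ⟨c, _, _, τ, hτ, Λ, hΛ, rfl, hC⟩, hσ⟩
  · rintro ⟨_, ⟨c, _, _, τ, hτ, Λ, hΛ, rfl, hC⟩, hσ⟩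
    exact ⟨c, _, _, τ, Λ, hτ, hΛ, hσ, hC⟩

theorem CatalystStep.map_right {f : Fin N → Type} [∀ p, Fintype (f p)] [∀ p, DecidableEq (f p)]
    {ρ : Op d} {τ : Op c} {η : Op e} {τ' : Op c'} (h : CatalystStep ρ τ η τ')
    {Λ : Op c' → Op f} (hΛ : IsLOCC Λ) : CatalystStep ρ τ η (Λ τ') := by
  obtain ⟨Γ, hΓ, rfl, rfl⟩ := h
  refine ⟨_, ((hΓ.comp .swap).comp (hΛ.ampl e)).comp .swap, ?_, ?_⟩
  · rw [marginalS_swap, marginalC_ampl hΛ, marginalC_swap]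
  · rw [marginalC_swap, marginalS_ampl hΛ.isLinearMap, marginalS_swap]

theorem CatalystStep.map_left {f : Fin N → Type} [∀ p, Fintype (f p)] [∀ p, DecidableEq (f p)]
    {ρ : Op d} {τ : Op f} {η : Op e} {τ' : Op c'} {Λ : Op f → Op c} (hΛ : IsLOCC Λ)
    (h : CatalystStep ρ (Λ τ) η τ') : CatalystStep ρ τ η τ' := by
  obtain ⟨Γ, hΓ, hη, hτ'⟩ := h
  have hin : swap (ampl d Λ (swap (tensor ρ τ))) = tensor ρ (Λ τ) := by
    rw [swap_tensor, ampl_tensor hΛ.isLinearMap, swap_tensor]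
  exact ⟨_, (((IsLOCC.swap.comp (hΛ.ampl d)).comp .swap).comp hΓ), by rwa [hin], by rwa [hin]⟩

/- The catalyst is the uniform mixture of the states `|k⟩⟨k| ⊗ T k`, which the steps permute. -/
theorem isCatalyticOutput_average [NeZero N] {K : Type} [Fintype K] [Nonempty K]
    {V : K → Fin N → Type} [∀ k p, Fintype (V k p)] [∀ k p, DecidableEq (V k p)]
    {ρ : Op d} (hρ : IsState ρ) {T : ∀ k, Op (V k)} (hT : ∀ k, IsState (T k)) {R : K → Op e}
    (π : Equiv.Perm K) (hstep : ∀ k, CatalystStep ρ (T k) (R k) (T (π k))) :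
    IsCatalyticOutput ρ ((Fintype.card K : ℂ)⁻¹ • ∑ k, R k) := by
  classical
  choose G hG hGS hGC using fun k => (hstep k).map_right (IsLOCC.sector (π k))
  have hne (p) : Nonempty (Joint e (Sector V) p) :=
    ((hG (Classical.arbitrary K)).isState (hρ.tensor (hT _))).nonempty p
  obtain ⟨Λ, hΛ, hΛG⟩ := IsLOCC.exists_sectorwise hG
  let τ := (Fintype.card K : ℂ)⁻¹ • ∑ k, sector k (T k)
  have hout : Λ (tensor ρ τ) = (Fintype.card K : ℂ)⁻¹ • ∑ k, G k (tensor ρ (T k)) := by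
    let L := IsLinearMap.mk' Λ hΛ.isLinearMap ∘ₗ IsLinearMap.mk' _ (isLinearMap_tensor ρ)
    calc L τ = (Fintype.card K : ℂ)⁻¹ • ∑ k, L (sector k (T k)) := by rw [map_smul, map_sum]
      _ = _ := by simp only [← hΛG]; rfl
  have hmarginal {f : Fin N → Type} [∀ p, Fintype (f p)] [∀ p, DecidableEq (f p)]
      {Ψ : Op (Joint e (Sector V)) → Op f} (hΨ : IsLOCC Ψ) :
      Ψ (Λ (tensor ρ τ)) = (Fintype.card K : ℂ)⁻¹ • ∑ k, Ψ (G k (tensor ρ (T k))) := by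
    rw [hout, hΨ.isLinearMap.map_smul, hΨ.map_sum]
  refine ⟨_, _, _, τ, isState_average fun k => (IsLOCC.sector k).isState (hT k), Λ, hΛ, ?_, ?_⟩
  · simp only [hmarginal .marginalS, hGS]
  · simp only [hmarginal .marginalC, hGC]
    rw [Equiv.sum_comp π fun k => sector k (T k)]

end CatalystStep

section Reduction

variable {N : ℕ} {d e : Fin N → Type} [∀ p, Fintype (d p)] [∀ p, DecidableEq (d p)]
  [∀ p, Fintype (e p)] [∀ p, DecidableEq (e p)]

theorem catalystStep_shift {ρ : Op d} (hρ : IsState ρ) {a b : ℕ} (X : Op (Copies e (b + 1))) :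
    CatalystStep ρ (tensor (power ρ a) X) (marginalS (unconsCopy X))
      (tensor (power ρ (a + 1)) (marginalC (unconsCopy X))) := by
  let f (p) : Joint e (Joint (Copies d (a + 1)) (Copies e b)) p ≃
      Joint d (Joint (Copies d a) (Copies e (b + 1))) p :=
    { toFun x := (x.2.1 0, (Fin.tail x.2.1, Fin.cons x.1 x.2.2))
      invFun x := (x.2.2 0, (Fin.cons x.1 x.2.1, Fin.tail x.2.2))
      left_inv x := by simp
      right_inv x := by simp }
  have hf (x y : ∀ p, Joint e (Joint (Copies d (a + 1)) (Copies e b)) p) :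
      (tensor ρ (tensor (power ρ a) X)).submatrix (fun x p => f p (x p))
        (fun x p => f p (x p)) x y =
      power ρ (a + 1) (fun p => (x p).2.1) (fun p => (y p).2.1) *
        unconsCopy X (fun p => ((x p).1, (x p).2.2)) (fun p => ((y p).1, (y p).2.2)) := by
    rw [← consCopy_tensor_power]
    exact (mul_assoc _ _ _).symm
  refine ⟨_, IsLOCC.reindex f, ?_, ?_⟩
  · ext x y
    simp only [marginalS, Matrix.of_apply, hf, sum_joint]
    rw [← Finset.sum_mul_sum]
    exact (congrArg (· * _) (hρ.power (a + 1)).2).trans (one_mul _)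
  · ext x y
    calc _ = ∑ z : ∀ p, e p, power ρ (a + 1) (fun p => (x p).1) (fun p => (y p).1) *
          unconsCopy X (fun p => (z p, (x p).2)) (fun p => (z p, (y p).2)) :=
          Fintype.sum_congr _ _ fun _ => hf _ _
      _ = _ := (Finset.mul_sum ..).symm

theorem catalystStep_reset {ρ : Op d} {L : ℕ}
    {Λ : Op (Copies d (L + 1)) → Op (Copies e (L + 1))} (hΛ : IsLOCC Λ)
    {c : Fin N → Type} [∀ p, Fintype (c p)] [∀ p, DecidableEq (c p)]
    {Y : Op c} (hY : IsState Y) :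
    CatalystStep ρ (tensor (power ρ L) Y) (marginalS (unconsCopy (Λ (power ρ (L + 1)))))
      (tensor (power ρ 0) (marginalC (unconsCopy (Λ (power ρ (L + 1)))))) := by
  have hstep : CatalystStep ρ (power ρ L) (marginalS (unconsCopy (Λ (power ρ (L + 1)))))
      (marginalC (unconsCopy (Λ (power ρ (L + 1))))) := by
    rw [← consCopy_tensor_power]
    exact ⟨_, (IsLOCC.consCopy.comp hΛ).comp .unconsCopy, rfl, rfl⟩
  have hin : marginalS (tensor (power ρ L) Y) = power ρ L := by
    rw [marginalS_tensor, hY.2, one_smul]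
  have hout : IsLOCC (tensor (power ρ 0) : Op (Copies e L) → _) := by
    convert IsLOCC.reindex (d := Copies e L) (e := Joint (Copies d 0) (Copies e L))
      fun p => Equiv.uniqueProd (Copies e L p) (Copies d 0 p) using 1
    ext X x y
    exact one_mul _
  rw [← hin] at hstep
  exact (hstep.map_left .marginalS).map_right hout

theorem catalystStep_copyMarginal {ρ : Op d} (hρ : IsState ρ) {n a b c : ℕ} (hc : c = b + 1)
    (hcn : c ≤ n) {i : Fin n} (hi : i + c = n) (μ : Op (Copies e n)) :
    CatalystStep ρ (tensor (power ρ a) (lastCopies hcn μ)) (copyMarginal i μ)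
      (tensor (power ρ (a + 1)) (lastCopies (b := b) (by omega) μ)) := by
  subst hc
  have h := catalystStep_shift hρ (a := a) (lastCopies hcn μ)
  rw [← lastCopies_eq_marginalC, ← copyMarginal_zero, copyMarginal_lastCopies] at h
  convert h
  simp only [Fin.val_zero]
  omega

theorem isCatalyticOutput_average_copyMarginal [NeZero N] {ρ : Op d} (hρ : IsState ρ) {n : ℕ}
    (hn : 0 < n) {Λ : Op (Copies d n) → Op (Copies e n)} (hΛ : IsLOCC Λ) :
    IsCatalyticOutput ρ ((n : ℂ)⁻¹ • ∑ i, copyMarginal i (Λ (power ρ n))) := by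
  obtain ⟨L, rfl⟩ := Nat.exists_eq_add_one.2 hn
  set μ := Λ (power ρ (L + 1))
  have hμs : IsState μ := hΛ.isState (hρ.power _)
  let T (k : Fin (L + 1)) : Op (Joint (Copies d k) (Copies e (L - k))) :=
    tensor (power ρ k) (lastCopies (by omega) μ)
  have hstep (k) : CatalystStep ρ (T k) (copyMarginal (finRotate (L + 1) k) μ)
      (T (finRotate (L + 1) k)) := by
    induction k using Fin.lastCases with
    | last =>
      have h : lastCopies (Nat.le_succ L) μ = marginalC (unconsCopy μ) := by
        rw [lastCopies_eq_marginalC le_rfl, lastCopies_self]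
      rw [finRotate_last, copyMarginal_zero]
      change CatalystStep ρ _ _ (tensor (power ρ 0) (lastCopies (Nat.le_succ L) μ))
      rw [h]
      exact catalystStep_reset hΛ (hμs.lastCopies _)
    | cast i =>
      rw [finRotate_apply, Fin.coeSucc_eq_succ]
      exact catalystStep_copyMarginal hρ (a := i) (b := L - (i + 1)) (c := L - i) (by omega)
        (by omega) (by simp; omega) μ
  have := isCatalyticOutput_average hρ (T := T)
    (fun k => (hρ.power _).tensor (hμs.lastCopies _)) _ hstep
  rwa [Fintype.card_fin, Equiv.sum_comp (finRotate (L + 1)) fun i => copyMarginal i μ] at this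

theorem exists_isLOCC_padding [∀ p, Nonempty (e p)] (m j : ℕ) :
    ∃ Γ : Op (Copies e m) → Op (Copies e (m + j)), IsLOCC Γ ∧
      ∀ {σ μ b}, IsState σ → IsState μ → TraceBound b (∑ i, (copyMarginal i μ - σ)) →
        TraceBound (2 * j + b) (∑ i, (copyMarginal i (Γ μ) - σ)) := by
  induction j with
  | zero => exact ⟨_, .done, fun _ _ h => by simpa using h⟩
  | succ j ih =>
    obtain ⟨Γ, hΓ, hbound⟩ := ih
    have hΓ' := (hΓ.comp (.prepend fun p => Classical.arbitrary (e p))).comp .consCopy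
    refine ⟨_, hΓ', fun {σ μ b} hσ hμ h => ?_⟩
    rw [show 2 * ((j + 1 : ℕ) : ℝ) + b = 2 + (2 * j + b) by push_cast; ring]
    change TraceBound _ (∑ i : Fin (m + j + 1), (copyMarginal i (consCopy (prepend _ (Γ μ))) - σ))
    rw [Fin.sum_univ_succ]
    refine (TraceBound.sub_of_isState ((IsLOCC.copyMarginal 0).isState (hΓ'.isState hμ)) hσ).add ?_
    simp only [copyMarginal_succ, unconsCopy_consCopy, marginalC_prepend]
    exact hbound hσ hμ h

theorem MarginallyReducible.catalyticallyConvertible [NeZero N] {ρ : Op d} {σ : Op e}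
    (hρ : IsState ρ) (hσ : IsState σ) (h : MarginallyReducible ρ σ) :
    CatalyticallyConvertible ρ σ := by
  have hne := hσ.nonempty
  refine catalyticallyConvertible_iff.2 fun ε hε => ?_
  obtain ⟨m, n, hn, hmn, Λ, hΛ, hclose, hrate⟩ := h (ε / 2) (by linarith) (ε / 4) (by linarith)
  obtain ⟨j, rfl⟩ := Nat.exists_eq_add_of_le hmn
  obtain ⟨Γ, hΓ, hpad⟩ := exists_isLOCC_padding (e := e) m j
  have hμ := hΛ.isState (hρ.power (m + j))
  refine ⟨_, isCatalyticOutput_average_copyMarginal hρ hn (hΛ.comp hΓ), ?_⟩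
  have hsum : TraceBound (∑ _i : Fin m, ε / 2)
      (∑ i, (copyMarginal i (Λ (power ρ (m + j))) - σ)) :=
    .sum _ fun i _ => (TraceBound.of_traceNorm
      (((IsLOCC.copyMarginal i).posSemidef hμ.1).1.sub hσ.1.1)).mono (hclose i).le
  have : Nonempty (Fin (m + j)) := Fin.pos_iff_nonempty.1 hn
  have haverage := (hpad hσ hμ hsum).average_sub
  rw [Fintype.card_fin] at haverage
  refine haverage.traceNorm_le.trans_lt ?_
  have hn' : (0 : ℝ) < (m + j : ℕ) := Nat.cast_pos.2 hn
  have hj : (j : ℝ) < ε / 4 * (m + j : ℕ) := by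
    have := mul_lt_mul_of_pos_right hrate hn'
    rw [one_mul, add_mul, div_mul_cancel₀ _ hn'.ne', Nat.cast_add] at this
    push_cast at this ⊢
    linarith
  have hj₀ : 0 ≤ ε * j := by positivity
  rw [inv_mul_lt_iff₀ hn', Fin.sum_const, nsmul_eq_mul]
  push_cast at hj ⊢
  linarith

end Reduction

section PureStates

variable {ι κ : Type*}

/-- The operator `|φ⟩⟨φ|`; the vector `φ` need not be normalised. -/
def pureOp (φ : ι → ℂ) : Matrix ι ι ℂ := Matrix.vecMulVec φ (star φ)

theorem pureOp_apply (φ : ι → ℂ) (x y : ι) : pureOp φ x y = φ x * star (φ y) := rfl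

theorem pureOp_smul (w : ℂ) (φ : ι → ℂ) : pureOp (w • φ) = (w * star w) • pureOp φ := by
  ext x y
  simp only [pureOp_apply, Pi.smul_apply, Matrix.smul_apply, smul_eq_mul, star_mul']
  ring

theorem mul_pureOp_mul_conjTranspose [Fintype ι] (L : Matrix κ ι ℂ) (φ : ι → ℂ) :
    L * pureOp φ * Lᴴ = pureOp (L *ᵥ φ) := by
  rw [pureOp, pureOp, Matrix.mul_vecMulVec, Matrix.vecMulVec_mul, Matrix.star_mulVec]

open scoped MatrixOrder in
theorem exists_marginalS_pureOp_eq {N : ℕ} {c : Fin N → Type} [∀ p, Fintype (c p)] {τ : Op c}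
    (hτ : τ.PosSemidef) : ∃ φ : (∀ p, Joint c c p) → ℂ, marginalS (pureOp φ) = τ := by
  classical
  obtain ⟨B, rfl⟩ := CStarAlgebra.nonneg_iff_eq_star_mul_self.1 hτ.nonneg
  refine ⟨fun z => star (B (fun p => (z p).2) fun p => (z p).1), ?_⟩
  ext x y
  simp only [marginalS, Matrix.of_apply, pureOp_apply, star_star, Matrix.mul_apply,
    Matrix.star_apply]

variable {N : ℕ} {d e : Fin N → Type} [∀ p, Fintype (d p)] [∀ p, DecidableEq (d p)]
  [∀ p, Fintype (e p)] [∀ p, DecidableEq (e p)]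

theorem IsLOCC.exists_of_forall_mulVec_eq {κ : Fin N → Type} [∀ p, Fintype (κ p)]
    (A : ∀ p, κ p → Matrix (e p) (d p) ℂ) (hA : ∀ p, ∑ j, (A p j)ᴴ * A p j = 1)
    (H : (∀ p, κ p) → ∀ p, Matrix (e p) (e p) ℂ) (hH : ∀ k p, (H k p)ᴴ * H k p = 1)
    {φ : (∀ p, d p) → ℂ} (hφ : (pureOp φ).trace = 1)
    {ψ : (∀ p, e p) → ℂ} (hψ : (pureOp ψ).trace = 1)
    (h : ∀ k, ∃ w : ℂ, localProd (fun p => A p (k p)) *ᵥ φ = w • localProd (H k) *ᵥ ψ) :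
    ∃ Λ : Op d → Op e, IsLOCC Λ ∧ Λ (pureOp φ) = pureOp ψ := by
  choose w hw using h
  have hΛ := IsLOCC.round κ (fun p _ => e p) A hA _ fun k =>
    IsLOCC.conj_localProd (A := fun p => (H k p)ᴴ) fun p => by
      rw [Matrix.conjTranspose_conjTranspose, mul_eq_one_comm.1 (hH k p)]
  have hbranch (k) : localProd (fun p => (H k p)ᴴ) *
      (localProd (fun p => A p (k p)) * pureOp φ * (localProd fun p => A p (k p))ᴴ) *
        (localProd fun p => (H k p)ᴴ)ᴴ = (w k * star (w k)) • pureOp ψ := by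
    rw [mul_pureOp_mul_conjTranspose, mul_pureOp_mul_conjTranspose, hw, Matrix.mulVec_smul,
      Matrix.mulVec_mulVec, localProd_mul, funext (hH k), localProd_one, Matrix.one_mulVec,
      pureOp_smul]
  have htrace := hΛ.trace (pureOp φ)
  refine ⟨_, hΛ, ?_⟩
  simp only [hbranch, ← Finset.sum_smul] at htrace ⊢
  rw [Matrix.trace_smul, hφ, hψ, smul_eq_mul, mul_one] at htrace
  rw [htrace, one_smul]

theorem IsLOCC.exists_leftInverse_embed [∀ p, Nonempty (d p)] {f : ∀ p, d p → e p}
    (hf : ∀ p, (f p).Injective) :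
    ∃ Λ : Op e → Op d, IsLOCC Λ ∧ Function.LeftInverse Λ (QEnt.embed f) := by
  classical
  let a p : e p := f p (Classical.arbitrary (d p))
  let g p (z : e p) : e p × d p :=
    (if z ∈ Set.range (f p) then a p else z, Function.invFun (f p) z)
  have hg p : (g p).Injective := by
    intro z z' h
    obtain ⟨h₁, h₂⟩ := Prod.ext_iff.1 h
    by_cases hz : z ∈ Set.range (f p) <;> by_cases hz' : z' ∈ Set.range (f p)
    · rw [← Function.invFun_eq hz, ← Function.invFun_eq hz']
      exact congrArg (f p) h₂
    · exact absurd ⟨_, by simpa [g, a, hz, hz'] using h₁⟩ hz'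
    · exact absurd ⟨_, by simpa [g, a, hz, hz', eq_comm] using h₁⟩ hz
    · simpa [g, hz, hz'] using h₁
  have hgf p : g p ∘ f p = fun x => (a p, x) :=
    funext fun x => Prod.ext (if_pos ⟨x, rfl⟩) (Function.leftInverse_invFun (hf p) x)
  refine ⟨_, (IsLOCC.embed hg).comp .marginalC, fun X => ?_⟩
  rw [embed_embed, funext hgf]
  exact marginalC_prepend a X

end PureStates

section RankOneMeasurement

variable {κ α β γ : Type*} [Fintype κ] [DecidableEq α] [DecidableEq β]

/-- The matrices `P k` are, up to normalisation, an orthonormal basis of all `α × β` matrices: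
regarded as vectors of `ℂ ^ α ⊗ ℂ ^ β` they are the outcomes of a complete measurement. -/
def IsRankOneMeasurement (P : κ → Matrix α β ℂ) : Prop :=
  ∀ v v' u u', ∑ k, star (P k v u) * P k v' u' =
    (1 : Matrix α α ℂ) v v' * (1 : Matrix β β ℂ) u u'

theorem IsRankOneMeasurement.piTensor {ι : Type*} [Fintype ι] [DecidableEq ι]
    {P : κ → Matrix α β ℂ} (hP : IsRankOneMeasurement P) :
    IsRankOneMeasurement fun k : ι → κ => piTensor fun i => P (k i) := by
  intro v v' u u'
  simp only [piTensor_apply, star_prod, ← Finset.prod_mul_distrib]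
  rw [← Fintype.piFinset_univ, ← Finset.prod_univ_sum (fun _ => Finset.univ)
    fun i j => star (P j (v i) (u i)) * P j (v' i) (u' i)]
  simp only [hP _ _ _ _, Finset.prod_mul_distrib, ← piTensor_apply (fun _ => 1), piTensor_one]

theorem IsRankOneMeasurement.sum_conjTranspose_mul_self [Fintype α] [Fintype γ]
    {P : κ → Matrix α β ℂ} (hP : IsRankOneMeasurement P) (Ψ : Matrix γ α ℂ) :
    ∑ k, (Ψ * P k)ᴴ * (Ψ * P k) = (Ψᴴ * Ψ).trace • 1 := by
  ext u u'
  have hterm (k) : ((Ψ * P k)ᴴ * (Ψ * P k)) u u' =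
      ∑ v, ∑ v', (Ψᴴ * Ψ) v v' * (star (P k v u) * P k v' u') := by
    rw [Matrix.conjTranspose_mul, Matrix.mul_assoc, ← Matrix.mul_assoc Ψᴴ, Matrix.mul_apply]
    refine Finset.sum_congr rfl fun v _ => ?_
    rw [Matrix.mul_apply, Finset.mul_sum]
    exact Finset.sum_congr rfl fun v' _ => mul_left_comm _ _ _
  simp only [Matrix.sum_apply, hterm]
  rw [Finset.sum_comm]
  simp only [Finset.sum_comm (s := (Finset.univ : Finset κ)), ← Finset.mul_sum, hP _ _ _ _]
  simp [Matrix.one_apply, Matrix.trace]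

end RankOneMeasurement

section Pauli

/-- The Pauli operators `X ^ a * Z ^ b`, up to phases the corrections needed in teleportation. -/
def pauli (k : Fin 2 × Fin 2) : Matrix (Fin 2) (Fin 2) ℂ :=
  Matrix.of fun v u => if v = u + k.1 then (if k.2 = 1 ∧ u = 1 then -1 else 1) else 0

theorem pauli_mul_conjTranspose_self (k : Fin 2 × Fin 2) : pauli k * (pauli k)ᴴ = 1 := by
  obtain ⟨a, b⟩ := k
  ext v u
  fin_cases a <;> fin_cases b <;> fin_cases v <;> fin_cases u <;>
    simp [Matrix.mul_apply, pauli]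

/-- The matrices of the vectors of the Bell basis, which are those of a singlet with a Pauli
operator applied to one half. -/
noncomputable def bell (k : Fin 2 × Fin 2) : Matrix (Fin 2) (Fin 2) ℂ :=
  pauli k * (Matrix.of singlet)ᴴ

theorem inv_sqrt_two_mul_self : ((√2 : ℝ) : ℂ)⁻¹ * ((√2 : ℝ) : ℂ)⁻¹ = 2⁻¹ := by
  rw [← mul_inv, ← Complex.ofReal_mul, Real.mul_self_sqrt two_pos.le, Complex.ofReal_ofNat]

theorem conjTranspose_singlet_mul_singlet :
    (Matrix.of singlet)ᴴ * Matrix.of singlet = (2⁻¹ : ℂ) • 1 := by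
  ext v u
  fin_cases v <;> fin_cases u <;> simp [Matrix.mul_apply, singlet, inv_sqrt_two_mul_self, neg_div]

theorem bell_mul_singlet (k : Fin 2 × Fin 2) :
    bell k * Matrix.of singlet = (2⁻¹ : ℂ) • pauli k := by
  rw [bell, Matrix.mul_assoc, conjTranspose_singlet_mul_singlet, Matrix.mul_smul, Matrix.mul_one]

theorem isRankOneMeasurement_bell : IsRankOneMeasurement bell := by
  intro v v' u u'
  fin_cases v <;> fin_cases v' <;> fin_cases u <;> fin_cases u' <;>
    simp [Fintype.sum_prod_type, bell, Matrix.mul_apply, pauli, singlet, neg_div,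
      inv_sqrt_two_mul_self] <;> norm_num

end Pauli

section Singlets

/-- The vector `φ ^ {⊗ n}`. -/
def vecPower {N : ℕ} {d : Fin N → Type} (φ : (∀ p, d p) → ℂ) (n : ℕ) (x : ∀ p, Copies d n p) :
    ℂ :=
  ∏ i, φ fun p => x p i

theorem power_pureOp {N : ℕ} {d : Fin N → Type} (φ : (∀ p, d p) → ℂ) (n : ℕ) :
    power (pureOp φ) n = pureOp (vecPower φ n) := by
  ext x y
  simp only [power, Matrix.of_apply, pureOp_apply, vecPower, star_prod, Finset.prod_mul_distrib]

variable (N : ℕ)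

/-- The vector of the state `pairSinglets N`. -/
noncomputable def pairVec (x : ∀ p, PairQubits N p) : ℂ :=
  ∏ pq : {pq : Fin N × Fin N // pq.1 < pq.2},
    singlet (x pq.1.1 ⟨pq.1.2, pq.2.ne'⟩) (x pq.1.2 ⟨pq.1.1, pq.2.ne⟩)

theorem pairSinglets_eq_pureOp : pairSinglets N = pureOp (pairVec N) := rfl

/-- The qubits of all parties, grouped by pairs of parties. -/
def pairEquiv : (∀ p, PairQubits N p) ≃
    ({pq : Fin N × Fin N // pq.1 < pq.2} → Fin 2 × Fin 2) where
  toFun x pq := (x pq.1.1 ⟨pq.1.2, pq.2.ne'⟩, x pq.1.2 ⟨pq.1.1, pq.2.ne⟩)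
  invFun g p q := if h : p < q.1 then (g ⟨(p, q.1), h⟩).1
    else (g ⟨(q.1, p), lt_of_le_of_ne (not_lt.1 h) q.2⟩).2
  left_inv x := by
    funext p q
    by_cases h : p < q.1 <;> simp [h]
  right_inv g := by
    funext pq
    have h : ¬ pq.1.2 < pq.1.1 := not_lt.2 pq.2.le
    simp [h, pq.2]

theorem isState_pairSinglets : IsState (pairSinglets N) := by
  refine ⟨Matrix.posSemidef_vecMulVec_self_star _, ?_⟩
  let w (t : Fin 2 × Fin 2) : ℂ := singlet t.1 t.2 * star (singlet t.1 t.2)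
  have hw : ∑ t, w t = 1 := by
    have h := congrArg Matrix.trace conjTranspose_singlet_mul_singlet
    simp only [Matrix.trace, Matrix.diag_apply, Matrix.mul_apply, Matrix.conjTranspose_apply,
      Matrix.of_apply, Matrix.smul_apply] at h
    rw [Fintype.sum_prod_type_right]
    simpa [w, mul_comm] using h
  calc (pairSinglets N).trace
      = ∑ x, ∏ pq, w (pairEquiv N x pq) := by
        rw [pairSinglets_eq_pureOp, Matrix.trace]
        simp only [Matrix.diag_apply, pureOp_apply, pairVec, star_prod, ← Finset.prod_mul_distrib]
        rfl
    _ = ∏ _pq : {pq : Fin N × Fin N // pq.1 < pq.2}, ∑ t, w t := by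
        rw [(pairEquiv N).sum_comp fun g => ∏ pq, w (g pq), Finset.prod_univ_sum,
          Fintype.piFinset_univ]
    _ = 1 := by rw [hw, Finset.prod_const_one]

variable {N}

theorem prod_pairs_eq_mul_prod_ne {M : Type*} [CommMonoid M] {p₀ : Fin N} (hp₀ : IsBot p₀)
    (F : {pq : Fin N × Fin N // pq.1 < pq.2} → M) :
    ∏ pq, F pq = (∏ pq with pq.1.1 ≠ p₀, F pq) *
      ∏ q : {q // q ≠ p₀}, F ⟨(p₀, q), (hp₀ q).lt_of_ne q.2.symm⟩ := by
  rw [← Finset.prod_filter_mul_prod_filter_not Finset.univ fun pq => pq.1.1 ≠ p₀]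
  congr 1
  refine Finset.prod_bij' (fun pq _ => ⟨pq.1.2, ((hp₀ pq.1.1).trans_lt pq.2).ne'⟩)
    (fun q _ => ⟨(p₀, q), (hp₀ q).lt_of_ne q.2.symm⟩) (by simp) (by simp) ?_ (by simp) ?_ <;>
  · rintro ⟨⟨p, q⟩, h⟩ hpq
    obtain rfl : p = p₀ := by simpa using hpq
    rfl

end Singlets

section Teleportation

variable {N M : ℕ}

/-- The system consisting of `M` qubits for each party. -/
abbrev Qubits (N M : ℕ) : Fin N → Type := fun _ => Fin M → Fin 2

/-- The tensor product of the one-qubit operators `P i q` on the halves, held by `p`, of `M` pairs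
shared with each other party `q`. -/
def pairTensor {p : Fin N} (P : Fin M → {q // q ≠ p} → Matrix (Fin 2) (Fin 2) ℂ) :
    Matrix (Copies (PairQubits N) M p) (Copies (PairQubits N) M p) ℂ :=
  piTensor fun i => piTensor (P i)

theorem pairTensor_apply {p : Fin N} (P : Fin M → {q // q ≠ p} → Matrix (Fin 2) (Fin 2) ℂ)
    (v u : Copies (PairQubits N) M p) :
    pairTensor P v u = ∏ i, ∏ q, P i q (v i q) (u i q) := rfl

theorem pairTensor_mul {p : Fin N} (P Q : Fin M → {q // q ≠ p} → Matrix (Fin 2) (Fin 2) ℂ) :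
    pairTensor P * pairTensor Q = pairTensor fun i q => P i q * Q i q := by
  unfold pairTensor
  rw [piTensor_mul]
  simp only [piTensor_mul]

theorem pairTensor_smul {p : Fin N} (w : ℂ)
    (P : Fin M → {q // q ≠ p} → Matrix (Fin 2) (Fin 2) ℂ) :
    pairTensor (fun i q => w • P i q) = (∏ _i : Fin M, ∏ _q : {q // q ≠ p}, w) • pairTensor P := by
  simp only [pairTensor, piTensor_smul]

variable (M) in
/-- The coefficients, as a matrix, of the vector of `M` singlets shared by `p` with each other
party; the columns are labelled by the halves that `p` does not hold. -/
noncomputable def singletTensor (p : Fin N) :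
    Matrix (Copies (PairQubits N) M p) (Copies (PairQubits N) M p) ℂ :=
  pairTensor fun _ _ => Matrix.of singlet

/-- The qubits of all parties as those of `p` and those of the others; the latter are arranged
like the halves, held by `p`, of pairs shared with the others. -/
def splitParty (p : Fin N) :
    (∀ q, Qubits N M q) ≃ (Fin M → Fin 2) × Copies (PairQubits N) M p where
  toFun y := (y p, fun i q => y q i)
  invFun yv q := if h : q = p then yv.1 else fun i => yv.2 i ⟨q, h⟩
  left_inv y := by
    funext q
    by_cases h : q = p
    · subst h; exact dif_pos rfl
    · exact dif_neg h
  right_inv yv := Prod.ext (dif_pos rfl) (funext₂ fun i q => congrFun (dif_neg q.2) i)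

theorem splitParty_symm_self {p : Fin N} (yv : (Fin M → Fin 2) × Copies (PairQubits N) M p) :
    (splitParty p).symm yv p = yv.1 :=
  dif_pos rfl

theorem splitParty_symm_coe {p : Fin N} (yv : (Fin M → Fin 2) × Copies (PairQubits N) M p)
    (q : {q // q ≠ p}) (i : Fin M) : (splitParty p).symm yv q i = yv.2 i q :=
  congrFun (dif_neg q.2) i

/-- The vector `ψ` as an operator from the qubits of the other parties to those of `p`. -/
def partyMatrix (p : Fin N) (ψ : (∀ q, Qubits N M q) → ℂ) :
    Matrix (Fin M → Fin 2) (Copies (PairQubits N) M p) ℂ :=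
  Matrix.of fun y v => ψ ((splitParty p).symm (y, v))

theorem trace_conjTranspose_partyMatrix_mul_self (p : Fin N) (ψ : (∀ q, Qubits N M q) → ℂ) :
    ((partyMatrix p ψ)ᴴ * partyMatrix p ψ).trace = (pureOp ψ).trace := by
  calc ((partyMatrix p ψ)ᴴ * partyMatrix p ψ).trace
      = ∑ v, ∑ y, ψ ((splitParty p).symm (y, v)) * star (ψ ((splitParty p).symm (y, v))) :=
        Finset.sum_congr rfl fun v _ => Finset.sum_congr rfl fun y _ => mul_comm _ _
    _ = ∑ x, ψ x * star (ψ x) := by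
        rw [← Fintype.sum_prod_type_right (f := fun x => ψ ((splitParty p).symm x) *
          star (ψ ((splitParty p).symm x)))]
        exact (splitParty p).symm.sum_comp fun x => ψ x * star (ψ x)

/-- The Kraus operator, with outcome `k`, of the party `p` that teleports the shares of the other
parties of the state with vector `ψ` through its halves of shared singlets. -/
noncomputable def sender (p : Fin N) (ψ : (∀ q, Qubits N M q) → ℂ)
    (k : Fin M → {q // q ≠ p} → Fin 2 × Fin 2) :
    Matrix (Fin M → Fin 2) (Copies (PairQubits N) M p) ℂ :=
  partyMatrix p ψ * pairTensor fun i q => bell (k i q)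

theorem sum_sender_conjTranspose_mul_self (p : Fin N) {ψ : (∀ q, Qubits N M q) → ℂ}
    (hψ : (pureOp ψ).trace = 1) :
    ∑ k, (sender p ψ k)ᴴ * sender p ψ k = 1 := by
  have h := isRankOneMeasurement_bell.piTensor (ι := {q // q ≠ p}) |>.piTensor (ι := Fin M)
  exact (h.sum_conjTranspose_mul_self (partyMatrix p ψ)).trans <| by
    rw [trace_conjTranspose_partyMatrix_mul_self, hψ, one_smul]

theorem sender_mul_singlets (p : Fin N) (ψ : (∀ q, Qubits N M q) → ℂ)
    (k : Fin M → {q // q ≠ p} → Fin 2 × Fin 2) :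
    sender p ψ k * singletTensor M p =
      (∏ _i : Fin M, ∏ _q : {q // q ≠ p}, (2⁻¹ : ℂ)) •
        (partyMatrix p ψ * pairTensor fun i q => pauli (k i q)) := by
  rw [sender, singletTensor, Matrix.mul_assoc, pairTensor_mul]
  simp only [bell_mul_singlet, pairTensor_smul, Matrix.mul_smul]

/-- The qubits of party `p` in terms of those that it shares with `p₀` and the other ones. -/
def glue (p₀ p : Fin N) (z : Fin M → {q : {q // q ≠ p} // q.1 ≠ p₀} → Fin 2)
    (y : Fin M → Fin 2) : Copies (PairQubits N) M p :=
  fun i q => if h : q.1 = p₀ then y i else z i ⟨q, h⟩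

/-- For `p ≠ p₀`, `glue` is a bijection. -/
def glueEquiv {p₀ p : Fin N} (hp : p ≠ p₀) :
    (Σ _z : Fin M → {q : {q // q ≠ p} // q.1 ≠ p₀} → Fin 2, Fin M → Fin 2) ≃
      Copies (PairQubits N) M p where
  toFun zy := glue p₀ p zy.1 zy.2
  invFun x := ⟨fun i q => x i q, fun i => x i ⟨p₀, hp.symm⟩⟩
  left_inv zy := by
    refine Sigma.ext (funext₂ fun i q => dif_neg q.2) (heq_of_eq ?_)
    exact funext fun i => dif_pos rfl
  right_inv x := by
    funext i q
    by_cases h : q.1 = p₀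
    · exact (dif_pos h).trans (congrArg (x i) (Subtype.ext h.symm))
    · exact dif_neg h

/-- The Kraus operator, with outcome `z`, of the measurement in the computational basis of the
qubits of `p` that are not shared with `p₀`. -/
def receiver (p₀ p : Fin N) (z : Fin M → {q : {q // q ≠ p} // q.1 ≠ p₀} → Fin 2) :
    Matrix (Fin M → Fin 2) (Copies (PairQubits N) M p) ℂ :=
  (1 : Matrix (Copies (PairQubits N) M p) _ ℂ).submatrix (glue p₀ p z) id

theorem sum_receiver_conjTranspose_mul_self {p₀ p : Fin N} (hp : p ≠ p₀) :
    ∑ z, (receiver (M := M) p₀ p z)ᴴ * receiver p₀ p z = 1 :=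
  sum_one_submatrix_conjTranspose_mul_self (glueEquiv hp)

theorem exists_vecPower_pairVec_glue_eq {p₀ : Fin N} (hp₀ : IsBot p₀)
    (z : ∀ p, Fin M → {q : {q // q ≠ p} // q.1 ≠ p₀} → Fin 2) :
    ∃ r : ℂ, ∀ (u : Copies (PairQubits N) M p₀) (y : ∀ p, Qubits N M p),
      vecPower (pairVec N) M (Function.update (fun p => glue p₀ p (z p) (y p)) p₀ u) =
        r * singletTensor M p₀ u (splitParty p₀ y).2 := by
  refine ⟨∏ i, ∏ pq : {pq : Fin N × Fin N // pq.1 < pq.2} with pq.1.1 ≠ p₀,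
    singlet (glue p₀ pq.1.1 (z pq.1.1) 0 i ⟨pq.1.2, pq.2.ne'⟩)
      (glue p₀ pq.1.2 (z pq.1.2) 0 i ⟨pq.1.1, pq.2.ne⟩), fun u y => ?_⟩
  rw [vecPower, singletTensor, pairTensor_apply, ← Finset.prod_mul_distrib]
  refine Finset.prod_congr rfl fun i _ => ?_
  rw [pairVec, prod_pairs_eq_mul_prod_ne hp₀]
  congr 1
  · refine Finset.prod_congr rfl fun pq hpq => ?_
    have h₁ : pq.1.1 ≠ p₀ := (Finset.mem_filter.1 hpq).2
    have h₂ : pq.1.2 ≠ p₀ := ((hp₀ pq.1.1).trans_lt pq.2).ne'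
    simp [glue, h₁, h₂]
  · refine Finset.prod_congr rfl fun q _ => ?_
    simp [Function.update_of_ne q.2, glue, splitParty]

/-- The Pauli distortions of the shares of the other parties in the branch `k` of the measurement
of `p₀`, to be undone by these parties. -/
def distortion (p₀ : Fin N) (k : Fin M → {q // q ≠ p₀} → Fin 2 × Fin 2) (p : Fin N) :
    Matrix (Fin M → Fin 2) (Fin M → Fin 2) ℂ :=
  if h : p ≠ p₀ then (piTensor fun i => pauli (k i ⟨p, h⟩))ᵀ else 1

theorem distortion_conjTranspose_mul_self (p₀ : Fin N)
    (k : Fin M → {q // q ≠ p₀} → Fin 2 × Fin 2) (p : Fin N) :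
    (distortion p₀ k p)ᴴ * distortion p₀ k p = 1 := by
  by_cases h : p ≠ p₀
  · rw [distortion, dif_pos h, Matrix.conjTranspose_transpose_eq_transpose_conjTranspose,
      ← Matrix.transpose_mul, piTensor_conjTranspose, piTensor_mul]
    simp only [pauli_mul_conjTranspose_self, piTensor_one, Matrix.transpose_one]
  · simp [distortion, h]

theorem localProd_distortion_mulVec_apply (p₀ : Fin N)
    (k : Fin M → {q // q ≠ p₀} → Fin 2 × Fin 2) (ψ : (∀ p, Qubits N M p) → ℂ)
    (y : ∀ p, Qubits N M p) :
    (localProd (distortion p₀ k) *ᵥ ψ) y =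
      (partyMatrix p₀ ψ * pairTensor fun i q => pauli (k i q))
        (y p₀) (splitParty p₀ y).2 := by
  have hentry (y' v) : localProd (distortion p₀ k) y ((splitParty p₀).symm (y', v)) =
      (1 : Matrix (Fin M → Fin 2) (Fin M → Fin 2) ℂ) (y p₀) y' *
        pairTensor (fun i q => pauli (k i q)) v (splitParty p₀ y).2 := by
    rw [localProd_apply, Fintype.prod_eq_mul_prod_subtype_ne _ p₀, pairTensor_apply,
      Finset.prod_comm]
    congr 1
    · rw [splitParty_symm_self, distortion, dif_neg (not_not.2 rfl)]
    · refine Finset.prod_congr rfl fun q _ => ?_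
      simp only [distortion, dif_pos q.2, Matrix.transpose_apply, piTensor_apply,
        splitParty_symm_coe]
      rfl
  rw [Matrix.mulVec, dotProduct, ← (splitParty p₀).symm.sum_comp, Fintype.sum_prod_type,
    Fintype.sum_eq_single (y p₀), Matrix.mul_apply]
  · simp only [hentry, Matrix.one_apply_eq, one_mul, mul_comm, partyMatrix, Matrix.of_apply]
  · intro y' hy'
    simp only [hentry, Matrix.one_apply_ne' hy', zero_mul, Finset.sum_const_zero]

end Teleportation

section Preparation

theorem sum_smul_conjTranspose_mul_self {ι ω κ m n : Type*} [Fintype ι] [Fintype ω] [Nonempty ω]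
    [Fintype κ] [Fintype m] [DecidableEq n] (s : ι ≃ ω × κ) {A : κ → Matrix m n ℂ}
    (hA : ∑ j, (A j)ᴴ * A j = 1) :
    ∑ i, (((√(Fintype.card ω) : ℝ) : ℂ)⁻¹ • A (s i).2)ᴴ *
      (((√(Fintype.card ω) : ℝ) : ℂ)⁻¹ • A (s i).2) = 1 := by
  set w : ℂ := ((√(Fintype.card ω) : ℝ) : ℂ)⁻¹ with hw
  have hcard : star w * w * Fintype.card ω = 1 := by
    have hstar : star w = w := by rw [hw, star_inv₀, Complex.star_def, Complex.conj_ofReal]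
    rw [hstar, hw, ← mul_inv, ← Complex.ofReal_mul, Real.mul_self_sqrt (Nat.cast_nonneg _),
      Complex.ofReal_natCast, inv_mul_cancel₀ (Nat.cast_ne_zero.2 Fintype.card_ne_zero)]
  calc ∑ i, (w • A (s i).2)ᴴ * (w • A (s i).2)
      = ∑ j : ω × κ, (star w * w) • ((A j.2)ᴴ * A j.2) := by
        rw [← s.sum_comp]
        simp only [Matrix.conjTranspose_smul, Matrix.smul_mul, Matrix.mul_smul, smul_smul,
          mul_comm w]
    _ = (star w * w * Fintype.card ω) • ∑ j, (A j)ᴴ * A j := by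
        rw [Fintype.sum_prod_type]
        simp only [← Finset.smul_sum, Finset.sum_const, Finset.card_univ]
        rw [← Nat.cast_smul_eq_nsmul ℂ, smul_smul, mul_comm (star w * w)]
    _ = 1 := by rw [hcard, hA, one_smul]

theorem localProd_mulVec_apply_of_submatrix {N : ℕ} {d e : Fin N → Type} [∀ p, Fintype (d p)]
    [∀ p, DecidableEq (d p)] {p₀ : Fin N} {B : ∀ p, Matrix (e p) (d p) ℂ}
    {g : ∀ p, e p → d p} (hB : ∀ p ≠ p₀, B p = (1 : Matrix (d p) (d p) ℂ).submatrix (g p) id)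
    (φ : (∀ p, d p) → ℂ) (y : ∀ p, e p) :
    (localProd B *ᵥ φ) y =
      ∑ u, B p₀ (y p₀) u * φ (Function.update (fun p => g p (y p)) p₀ u) := by
  change ∑ x, localProd B y x * φ x = _
  refine (Fintype.sum_of_injective (Function.update (fun p => g p (y p)) p₀)
    (Function.update_injective _ p₀) _ (fun x => localProd B y x * φ x)
    (fun x hx => ?_) fun u => ?_).symm
  · have hne : ∃ p ≠ p₀, g p (y p) ≠ x p := by
      by_contra! h
      exact hx ⟨x p₀, (Function.update_eq_iff.2 ⟨rfl, fun p hp => h p hp⟩)⟩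
    obtain ⟨p, hp, hpx⟩ := hne
    rw [localProd_apply, Finset.prod_eq_zero (Finset.mem_univ p), zero_mul]
    rw [hB p hp, Matrix.submatrix_apply, id, Matrix.one_apply_ne hpx]
  · rw [localProd_apply, Fintype.prod_eq_single p₀, Function.update_self]
    intro p hp
    rw [hB p hp, Function.update_of_ne hp, Matrix.submatrix_apply, id, Matrix.one_apply_eq]

variable {N M : ℕ}

theorem exists_localProd_sender_receiver_mulVec_eq {p₀ : Fin N} (hp₀ : IsBot p₀)
    (ψ : (∀ p, Qubits N M p) → ℂ) (k : ∀ p : Fin N, Fin M → {q // q ≠ p} → Fin 2 × Fin 2)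
    (z : ∀ p, Fin M → {q : {q // q ≠ p} // q.1 ≠ p₀} → Fin 2) :
    ∃ w : ℂ, localProd (fun p => if p = p₀ then sender p ψ (k p) else receiver p₀ p (z p)) *ᵥ
      vecPower (pairVec N) M = w • localProd (distortion p₀ (k p₀)) *ᵥ ψ := by
  obtain ⟨r, hr⟩ := exists_vecPower_pairVec_glue_eq (M := M) hp₀ z
  refine ⟨r * ∏ _i : Fin M, ∏ _q : {q // q ≠ p₀}, 2⁻¹, funext fun y => ?_⟩
  rw [localProd_mulVec_apply_of_submatrix (p₀ := p₀) (g := fun p => glue p₀ p (z p))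
    (fun p hp => if_neg hp : ∀ p ≠ p₀, _ = receiver p₀ p (z p))]
  calc ∑ u, (if p₀ = p₀ then sender p₀ ψ (k p₀) else receiver p₀ p₀ (z p₀)) (y p₀) u *
        vecPower (pairVec N) M (Function.update (fun p => glue p₀ p (z p) (y p)) p₀ u)
      = r * (sender p₀ ψ (k p₀) * singletTensor M p₀) (y p₀) (splitParty p₀ y).2 := by
        rw [Matrix.mul_apply, Finset.mul_sum]
        exact Finset.sum_congr rfl fun u _ => by rw [if_pos rfl, hr, mul_left_comm]
    _ = _ := by
        rw [sender_mul_singlets, Matrix.smul_apply, ← localProd_distortion_mulVec_apply,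
          Pi.smul_apply, smul_eq_mul, smul_eq_mul, mul_assoc]

theorem IsLOCC.exists_power_pairSinglets_eq_pureOp {p₀ : Fin N} (hp₀ : IsBot p₀)
    {ψ : (∀ p, Qubits N M p) → ℂ} (hψ : (pureOp ψ).trace = 1) :
    ∃ Λ : Op (Copies (PairQubits N) M) → Op (Qubits N M),
      IsLOCC Λ ∧ Λ (power (pairSinglets N) M) = pureOp ψ := by
  rw [pairSinglets_eq_pureOp, power_pureOp]
  let Z (p : Fin N) := Fin M → {q : {q // q ≠ p} // q.1 ≠ p₀} → Fin 2
  let K (p : Fin N) := Fin M → {q // q ≠ p} → Fin 2 × Fin 2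
  -- All parties need the same type of outcomes: that of `p₀` also carries a meaningless `z`, those
  -- of the others carry a meaningless `k`, whence the normalisation `w`.
  let w (p : Fin N) : ℂ := if p = p₀ then ((√(Fintype.card (Z p)) : ℝ) : ℂ)⁻¹ else
    ((√(Fintype.card (K p)) : ℝ) : ℂ)⁻¹
  let A (p : Fin N) (j : Z p × K p) : Matrix (Qubits N M p) (Copies (PairQubits N) M p) ℂ :=
    w p • if p = p₀ then sender p ψ j.2 else receiver p₀ p j.1
  refine IsLOCC.exists_of_forall_mulVec_eq A (fun p => ?_) (fun j => distortion p₀ (j p₀).2)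
    (fun j => distortion_conjTranspose_mul_self p₀ (j p₀).2) ?_ hψ fun j => ?_
  · by_cases hp : p = p₀
    · simp only [A, w, if_pos hp]
      exact sum_smul_conjTranspose_mul_self (Equiv.refl _)
        (sum_sender_conjTranspose_mul_self p hψ)
    · simp only [A, w, if_neg hp]
      exact sum_smul_conjTranspose_mul_self (Equiv.prodComm _ _)
        (sum_receiver_conjTranspose_mul_self hp)
  · rw [← power_pureOp]
    exact ((isState_pairSinglets N).power M).2
  · obtain ⟨r, hr⟩ := exists_localProd_sender_receiver_mulVec_eq hp₀ ψ (fun p => (j p).2)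
      fun p => (j p).1
    refine ⟨(∏ p, w p) * r, ?_⟩
    have hA : localProd (fun p => A p (j p)) = (∏ p, w p) • localProd fun p =>
        if p = p₀ then sender p ψ (j p).2 else receiver p₀ p (j p).1 := piTensor_smul w _
    rw [hA, Matrix.smul_mulVec, hr, smul_smul]

theorem IsState.exists_pureOp_qubits {c : Fin N → Type} [∀ p, Fintype (c p)]
    [∀ p, DecidableEq (c p)] {τ : Op c} (hτ : IsState τ) :
    ∃ (M : ℕ) (ψ : (∀ p, Qubits N M p) → ℂ) (Λ : Op (Qubits N M) → Op c),
      (pureOp ψ).trace = 1 ∧ IsLOCC Λ ∧ Λ (pureOp ψ) = τ := by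
  obtain ⟨φ, hφ⟩ := exists_marginalS_pureOp_eq hτ.1
  have (p : Fin N) : Nonempty (Joint c c p) := (hτ.nonempty p).map fun x => (x, x)
  let M := ∑ p, Fintype.card (Joint c c p)
  have hf p : ∃ f : Joint c c p → Qubits N M p, f.Injective := by
    refine (Function.Embedding.nonempty_of_card_le ?_).elim fun f => ⟨f, f.injective⟩
    calc Fintype.card (Joint c c p) ≤ M :=
          Finset.single_le_sum (f := fun p => Fintype.card (Joint c c p))
            (fun _ _ => Nat.zero_le _) (Finset.mem_univ p)
      _ ≤ Fintype.card (Qubits N M p) := by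
          rw [Fintype.card_fun, Fintype.card_fin, Fintype.card_fin]
          exact Nat.lt_two_pow_self.le
  choose f hf using hf
  obtain ⟨Λ, hΛ, hinv⟩ := IsLOCC.exists_leftInverse_embed hf
  have hpure : embed f (pureOp φ) = pureOp (basisMap f *ᵥ φ) := mul_pureOp_mul_conjTranspose _ _
  refine ⟨M, basisMap f *ᵥ φ, _, ?_, hΛ.comp .marginalS, ?_⟩
  · rw [← hpure, (IsLOCC.embed hf).trace, ← IsLOCC.marginalS.trace, hφ, hτ.2]
  · rw [← hpure, hinv, hφ]

theorem exists_isLOCC_power_pairSinglets_eq [NeZero N] {c : Fin N → Type} [∀ p, Fintype (c p)]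
    [∀ p, DecidableEq (c p)] {τ : Op c} (hτ : IsState τ) :
    ∃ (M : ℕ) (Λ : Op (Copies (PairQubits N) M) → Op c),
      IsLOCC Λ ∧ Λ (power (pairSinglets N) M) = τ := by
  obtain ⟨M, ψ, Γ, hψ, hΓ, rfl⟩ := hτ.exists_pureOp_qubits
  obtain ⟨Λ, hΛ, hψ'⟩ :=
    IsLOCC.exists_power_pairSinglets_eq_pureOp (p₀ := (0 : Fin N)) Fin.zero_le hψ
  exact ⟨M, _, hΛ.comp hΓ, congrArg Γ hψ'⟩

end Preparation

section Parallel

variable {N : ℕ} {d e c f : Fin N → Type} [∀ p, Fintype (d p)] [∀ p, Fintype (c p)]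

theorem TraceBound.tensor_left {b : ℝ} {X : Op d} (h : TraceBound b X) {τ : Op c}
    (hτ : IsState τ) : TraceBound b (tensor τ X) := by
  classical
  rw [← swap_tensor]
  exact IsLOCC.swap.traceBound (h.tensor_right hτ)

theorem TraceBound.tensor_sub_tensor {a b : ℝ} {X X' : Op d} {Y Y' : Op c}
    (h : TraceBound a (X - X')) (h' : TraceBound b (Y - Y')) (hY : IsState Y)
    (hX' : IsState X') : TraceBound (a + b) (tensor X Y - tensor X' Y') := by
  convert (h.tensor_right hY).add (h'.tensor_left hX') using 1
  ext x y
  simp only [tensor, Matrix.sub_apply, Matrix.add_apply, Matrix.of_apply]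
  ring

variable [∀ p, DecidableEq (d p)] [∀ p, DecidableEq (c p)] [∀ p, Fintype (e p)]
  [∀ p, DecidableEq (e p)] [∀ p, Fintype (f p)] [∀ p, DecidableEq (f p)]

theorem IsLOCC.exists_tensor {Λ : Op d → Op e} (hΛ : IsLOCC Λ) {Γ : Op c → Op f}
    (hΓ : IsLOCC Γ) : ∃ Θ : Op (Joint d c) → Op (Joint e f), IsLOCC Θ ∧
      ∀ ρ τ, Θ (tensor ρ τ) = tensor (Λ ρ) (Γ τ) := by
  refine ⟨_, (((hΛ.ampl c).comp .swap).comp (hΓ.ampl e)).comp .swap, fun ρ τ => ?_⟩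
  simp only [ampl_tensor hΛ.isLinearMap, swap_tensor, ampl_tensor hΓ.isLinearMap]

theorem IsLOCC.exists_splitCopies (ρ : Op d) (m n : ℕ) :
    ∃ Λ : Op (Copies d (m + n)) → Op (Joint (Copies d m) (Copies d n)), IsLOCC Λ ∧
      Λ (power ρ (m + n)) = tensor (power ρ m) (power ρ n) := by
  refine ⟨_, IsLOCC.reindex (d := Copies d (m + n)) (e := Joint (Copies d m) (Copies d n))
    fun p => Fin.appendEquiv m n, ?_⟩
  ext x y
  simp [power, tensor, Fin.prod_univ_add]

end Parallel

section Distillation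

variable {N : ℕ} {d : Fin N → Type} [∀ p, Fintype (d p)] [∀ p, DecidableEq (d p)]

theorem Distillable.exists_pairSinglets {ρ : Op d} (hρ : IsState ρ) (h : Distillable ρ) {ε : ℝ}
    (hε : 0 < ε) : ∃ (n : ℕ) (Λ : Op (Copies d n) → Op (PairQubits N)), IsLOCC Λ ∧
      TraceBound ε (Λ (power ρ n) - pairSinglets N) := by
  obtain ⟨r, hr, h⟩ := h
  obtain ⟨m, n, -, Λ, hΛ, hclose, hrate⟩ := h ε hε r hr
  have hΦ := isState_pairSinglets N
  cases m with
  | zero => simp at hrate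
  | succ m =>
    have hΓ := (IsLOCC.unconsCopy (d := PairQubits N) (n := m)).comp .marginalS
    have hfirst : marginalS (unconsCopy (power (pairSinglets N) (m + 1))) = pairSinglets N := by
      rw [← consCopy_tensor_power, unconsCopy_consCopy, marginalS_tensor, (hΦ.power m).2, one_smul]
    have hbound : TraceBound ε (Λ (power ρ n) - power (pairSinglets N) (m + 1)) :=
      (TraceBound.of_traceNorm ((hΛ.posSemidef (hρ.power n).1).1.sub (hΦ.power _).1.1)).mono
        hclose.le
    refine ⟨n, _, hΛ.comp hΓ, ?_⟩
    have := hΓ.traceBound hbound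
    rwa [hΓ.isLinearMap.map_sub, hfirst] at this

theorem Distillable.exists_power_pairSinglets {ρ : Op d} (hρ : IsState ρ) (h : Distillable ρ)
    (M : ℕ) {ε : ℝ} (hε : 0 < ε) :
    ∃ (n : ℕ) (Λ : Op (Copies d n) → Op (Copies (PairQubits N) M)), IsLOCC Λ ∧
      TraceBound ε (Λ (power ρ n) - power (pairSinglets N) M) := by
  induction M generalizing ε with
  | zero =>
    refine ⟨0, _, IsLOCC.reindex (d := Copies d 0) (e := Copies (PairQubits N) 0)
      fun p => Equiv.ofUnique _ _, ?_⟩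
    convert (TraceBound.zero (ι := ∀ p, Copies (PairQubits N) 0 p)).mono hε.le using 1
    ext x y
    simp [power_zero, Subsingleton.elim x y]
  | succ M ih =>
    obtain ⟨m, Λ, hΛ, hm⟩ := h.exists_pairSinglets hρ (half_pos hε)
    obtain ⟨n, Γ, hΓ, hn⟩ := ih (half_pos hε)
    obtain ⟨Δ, hΔ, hsplit⟩ := IsLOCC.exists_splitCopies ρ m n
    obtain ⟨Θ, hΘ, htensor⟩ := hΛ.exists_tensor hΓ
    refine ⟨m + n, _, (hΔ.comp hΘ).comp .consCopy, ?_⟩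
    rw [hsplit, htensor, ← consCopy_tensor_power, ← IsLOCC.consCopy.isLinearMap.map_sub,
      ← add_halves ε]
    exact IsLOCC.consCopy.traceBound
      (hm.tensor_sub_tensor hn (hΓ.isState (hρ.power n)) (isState_pairSinglets N))

theorem Distillable.exists_traceBound_sub [NeZero N] {c : Fin N → Type} [∀ p, Fintype (c p)]
    [∀ p, DecidableEq (c p)] {ρ : Op d} (hρ : IsState ρ) (h : Distillable ρ) {τ : Op c}
    (hτ : IsState τ) {ε : ℝ} (hε : 0 < ε) :
    ∃ (n : ℕ) (Λ : Op (Copies d n) → Op c), IsLOCC Λ ∧ TraceBound ε (Λ (power ρ n) - τ) := by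
  obtain ⟨M, Γ, hΓ, rfl⟩ := exists_isLOCC_power_pairSinglets_eq hτ
  obtain ⟨n, Λ, hΛ, hn⟩ := h.exists_power_pairSinglets hρ M hε
  refine ⟨n, _, hΛ.comp hΓ, ?_⟩
  rw [← hΓ.isLinearMap.map_sub]
  exact hΓ.traceBound hn

end Distillation

section Reuse

variable {N : ℕ} {d e b c f : Fin N → Type}

/-- Exchange of the last two parts of a system consisting of three parts. -/
def swapRight (X : Op (Joint (Joint d b) c)) : Op (Joint (Joint d c) b) :=
  X.submatrix (fun x p => (((x p).1.1, (x p).2), (x p).1.2))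
    fun x p => (((x p).1.1, (x p).2), (x p).1.2)

/-- Exchange of the outer two parts of a system consisting of three parts. -/
def swapOuter (X : Op (Joint (Joint e c) b)) : Op (Joint (Joint b c) e) :=
  X.submatrix (fun x p => (((x p).2, (x p).1.2), (x p).1.1))
    fun x p => (((x p).2, (x p).1.2), (x p).1.1)

theorem swapRight_tensor_tensor (ρ : Op d) (ω : Op b) (τ : Op c) :
    swapRight (tensor (tensor ρ ω) τ) = tensor (tensor ρ τ) ω := by
  ext x y
  exact mul_right_comm _ _ _

theorem marginalS_swapOuter_tensor [∀ p, Fintype (e p)] (X : Op (Joint e c)) (ω : Op b) :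
    marginalS (swapOuter (tensor X ω)) = tensor ω (marginalC X) := by
  ext x y
  simp only [marginalS, swapOuter, tensor, marginalC, Matrix.submatrix_apply, Matrix.of_apply,
    Finset.mul_sum, mul_comm]

variable [∀ p, Fintype (b p)] [∀ p, Fintype (c p)]

theorem marginalC_swapOuter_tensor (X : Op (Joint e c)) (ω : Op b) :
    marginalC (swapOuter (tensor X ω)) = ω.trace • marginalS X := by
  ext x y
  simp only [marginalC, swapOuter, tensor, Matrix.submatrix_apply, Matrix.of_apply, sum_joint,
    marginalS, Matrix.smul_apply, smul_eq_mul, Matrix.trace, Matrix.diag_apply, Finset.sum_mul_sum,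
    mul_comm]

variable [∀ p, DecidableEq (b p)] [∀ p, DecidableEq (c p)] [∀ p, Fintype (d p)]
  [∀ p, DecidableEq (d p)] [∀ p, Fintype (e p)] [∀ p, DecidableEq (e p)]

theorem IsLOCC.swapRight :
    IsLOCC (swapRight : Op (Joint (Joint d b) c) → Op (Joint (Joint d c) b)) :=
  IsLOCC.reindex (d := Joint (Joint d b) c) (e := Joint (Joint d c) b)
    fun _ => ⟨fun x => ((x.1.1, x.2), x.1.2), fun x => ((x.1.1, x.2), x.1.2), fun _ => rfl,
      fun _ => rfl⟩

theorem IsLOCC.swapOuter :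
    IsLOCC (swapOuter : Op (Joint (Joint e c) b) → Op (Joint (Joint b c) e)) :=
  IsLOCC.reindex (d := Joint (Joint e c) b) (e := Joint (Joint b c) e)
    fun _ => ⟨fun x => ((x.2, x.1.2), x.1.1), fun x => ((x.2, x.1.2), x.1.1), fun _ => rfl,
      fun _ => rfl⟩

theorem IsLOCC.exists_reuse_catalyst [∀ p, Fintype (f p)] [∀ p, DecidableEq (f p)] {ρ : Op d}
    {τ : Op c} {Λ : Op (Joint d c) → Op (Joint e c)} (hΛ : IsLOCC Λ)
    (hcat : QEnt.marginalC (Λ (tensor ρ τ)) = τ) {Ψ : Op (Joint b c) → Op f} (hΨ : IsLOCC Ψ) :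
    ∃ Θ : Op (Joint (Joint d b) c) → Op (Joint e f), IsLOCC Θ ∧ ∀ ω, IsState ω →
      QEnt.marginalS (Θ (tensor (tensor ρ ω) τ)) = QEnt.marginalS (Λ (tensor ρ τ)) ∧
      QEnt.marginalC (Θ (tensor (tensor ρ ω) τ)) = Ψ (tensor ω τ) := by
  refine ⟨_, (((IsLOCC.swapRight.comp (hΛ.ampl b)).comp .swapOuter).comp (hΨ.ampl e)).comp .swap,
    fun ω hω => ?_⟩
  rw [swapRight_tensor_tensor, ampl_tensor hΛ.isLinearMap]
  constructor
  · rw [marginalS_swap, marginalC_ampl hΨ, marginalC_swapOuter_tensor, hω.2, one_smul]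
  · rw [marginalC_swap, marginalS_ampl hΨ.isLinearMap, marginalS_swapOuter_tensor, hcat]

theorem IsLOCC.exists_copyMarginal_eq {ρ : Op d} (hρ : IsState ρ) {τ : Op c}
    {Λ : Op (Joint d c) → Op (Joint e c)} (hΛ : IsLOCC Λ)
    (hcat : QEnt.marginalC (Λ (tensor ρ τ)) = τ) (t : ℕ) :
    ∃ Ψ : Op (Joint (Copies d t) c) → Op (Copies e t), IsLOCC Ψ ∧ ∀ i,
      QEnt.copyMarginal i (Ψ (tensor (power ρ t) τ)) = QEnt.marginalS (Λ (tensor ρ τ)) := by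
  induction t with
  | zero =>
    obtain ⟨Ψ, hΨ⟩ := IsLOCC.exists_of_nonempty (Joint (Copies d 0) c) (Copies e 0)
    exact ⟨Ψ, hΨ, fun i => i.elim0⟩
  | succ t ih =>
    obtain ⟨Ψ, hΨ, hmarginal⟩ := ih
    obtain ⟨Θ, hΘ, hreuse⟩ := hΛ.exists_reuse_catalyst hcat hΨ
    obtain ⟨hS, hC⟩ := hreuse _ (hρ.power t)
    refine ⟨_, ((IsLOCC.unconsCopy.ampl c).comp hΘ).comp .consCopy, fun i => ?_⟩
    rw [ampl_tensor IsLOCC.unconsCopy.isLinearMap, ← consCopy_tensor_power, unconsCopy_consCopy]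
    cases i using Fin.cases with
    | zero => rw [copyMarginal_zero, unconsCopy_consCopy, hS]
    | succ i => rw [copyMarginal_succ, unconsCopy_consCopy, hC, hmarginal]

theorem CatalyticallyConvertible.marginallyReducible [NeZero N] {ρ : Op d} {σ : Op e}
    (hρ : IsState ρ) (hσ : IsState σ) (hdist : Distillable ρ)
    (h : CatalyticallyConvertible ρ σ) : MarginallyReducible ρ σ := by
  intro ε hε δ hδ
  obtain ⟨c, _, _, τ, Λ, hτ, hΛ, hclose, hcat⟩ := h (ε / 2) (half_pos hε)
  obtain ⟨n, Γ, hΓ, hprepare⟩ := hdist.exists_traceBound_sub hρ hτ (half_pos hε)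
  obtain ⟨t, ht⟩ := exists_nat_gt ((n : ℝ) / δ)
  obtain ⟨Ψ, hΨ, hmarginal⟩ := hΛ.exists_copyMarginal_eq hρ hcat t
  obtain ⟨Δ, hΔ, hsplit⟩ := IsLOCC.exists_splitCopies ρ n t
  have ht_pos : (0 : ℝ) < t := (div_nonneg n.cast_nonneg hδ.le).trans_lt ht
  refine ⟨t, n + t, by have := Nat.cast_pos.1 ht_pos; omega, by omega, _,
    ((hΔ.comp (hΓ.ampl (Copies d t))).comp .swap).comp hΨ, fun i => ?_, ?_⟩
  · rw [hsplit, ampl_tensor hΓ.isLinearMap, swap_tensor]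
    have hΨi := hΨ.comp (.copyMarginal i)
    have hcatalyst := hΨi.traceBound (hprepare.tensor_left (hρ.power t))
    rw [(isLinearMap_tensor _).map_sub, hΨi.isLinearMap.map_sub, hmarginal i] at hcatalyst
    have hconversion := TraceBound.of_traceNorm
      (((hΛ.comp .marginalS).posSemidef (hρ.tensor hτ).1).1.sub hσ.1.1)
    have hsum := (hcatalyst.add hconversion).traceNorm_le
    rw [sub_add_sub_cancel] at hsum
    linarith
  · have hn : (n : ℝ) < δ * (n + t) := by
      rw [div_lt_iff₀' hδ] at ht
      nlinarith [mul_nonneg hδ.le (n.cast_nonneg : (0 : ℝ) ≤ n)]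
    have hpos : (0 : ℝ) < n + t := by positivity
    push_cast
    rw [div_add' _ _ _ hpos.ne', lt_div_iff₀ hpos]
    linarith

end Reuse

end QEnt

open QEnt in
theorem theorem1 {N : ℕ} (hN : 2 ≤ N) {d e : Fin N → Type}
    [∀ p, Fintype (d p)] [∀ p, DecidableEq (d p)]
    [∀ p, Fintype (e p)] [∀ p, DecidableEq (e p)]
    (ρ : Op d) (σ : Op e) (hρ : IsState ρ) (hσ : IsState σ) :
    (Distillable ρ → Distillable σ →
      (MarginallyReducible ρ σ ↔ CatalyticallyConvertible ρ σ)) ∧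
    (MarginallyReducible ρ σ → CatalyticallyConvertible ρ σ) ∧
    (Distillable ρ → CatalyticallyConvertible ρ σ → MarginallyReducible ρ σ) := by
  have : NeZero N := ⟨by omega⟩
  have forward : MarginallyReducible ρ σ → CatalyticallyConvertible ρ σ :=
    MarginallyReducible.catalyticallyConvertible hρ hσ
  have converse : Distillable ρ → CatalyticallyConvertible ρ σ → MarginallyReducible ρ σ :=
    CatalyticallyConvertible.marginallyReducible hρ hσ
  exact ⟨fun hdist _ => ⟨forward, converse hdist⟩, forward, converse⟩
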